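/- Let $d\ge 2$ and let $b:[-1,1]\to[0,\infty)$ be measurable with $\int_{\mathbb S^{d-1}}b(\sigma\cdot e)\,d\sigma=1$ for every unit vector $e\in\mathbb R^d$, where $d\sigma$ is the surface measure of $\mathbb S^{d-1}$. For $\alpha\in(0,1]$, $v,v_*\in\mathbb R^d$ and $\sigma\in\mathbb S^{d-1}$ put $u=v-v_*$, $\hat u=u/|u|$ and $$v'=v+\tfrac{1+\alpha}{4}\,(|u|\sigma-u),\qquad v_*'=v_*-\tfrac{1+\alpha}{4}\,(|u|\sigma-u).$$ For $f,g:\mathbb R^d\to\mathbb R$, the collision operator $\mathcal Q_\alpha(g,f)$ is the locally integrable function such that, for every test function $\psi\in C_c^\infty(\mathbb R^d)$, $$\int_{\mathbb R^d}\mathcal Q_\alpha(g,f)\,\psi\,dv=\frac12\int_{\mathbb R^{d}\times\mathbb R^d}f(v)g(v_*)|u|\int_{\mathbb S^{d-1}}\big(\psi(v')+\psi(v_*')-\psi(v)-\psi(v_*)\big)b(\sigma\cdot\hat u)\,d\sigma\,dv_*\,dv ,$$ or, in the gain-minus-loss version $\mathcal Q_\alpha=\mathcal Q^+_\alpha-\mathcal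 Q^-_\alpha$ of which the former is the symmetrisation in $(f,g)$, $$\int_{\mathbb R^d}\mathcal Q_\alpha(g,f)\,\psi\,dv=\int_{\mathbb R^{d}\times\mathbb R^d}f(v)g(v_*)|u|\int_{\mathbb S^{d-1}}\big(\psi(v')-\psi(v)\big)b(\sigma\cdot\hat u)\,d\sigma\,dv_*\,dv .$$ Everything below holds for both versions. For $s\ge0$ let $m_s(v)=(1+|v|^2)^{s/2}$, and for $k\in\mathbb N=\{0,1,2,\dots\}$ and $p\in\{1,2\}$ let $W^{k,p}_v(m_s)$ be the weighted Sobolev space with norm $\|h\|_{W^{k,p}_v(m_s)}=\sum_{j=0}^{k}\big\|\,|\nabla^j_v h|\,m_s\big\|_{L^p(\mathbb R^d)}$ (weak derivatives). Let $a=\max\{d-1,2\}$, $k\in\mathbb N$ and $q\ge 0$. 1. There is a constant $c_{k,q}>0$ such that for all $\alpha\in(0,1]$ and all $f,g\in W^{k+1,1}_v(m_{q+2})$, the functions $\mathcal Q_1(g,f)$ and $\mathcal Q_\alpha(g,f)$ exist and $$\|\mathcal Q_1(g,f)-\mathcal Q_\alpha(g,f)\|_{W^{k,1}_v(m_q)}\le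 c_{k,q}\,\frac{1-\alpha}{\alpha^a}\Big(\|f\|_{W^{k,1}_v(m_{q+2})}\|g\|_{W^{k+1,1}_v(m_{q+2})}+\|g\|_{W^{k,1}_v(m_{q+2})}\|f\|_{W^{k+1,1}_v(m_{q+2})}\Big).$$ 2. For every $\kappa>d/2$ there is a constant $c_{k,q}(\kappa)>0$ such that for all $\alpha\in(0,1]$ and all $f,g\in W^{k+1,2}_v(m_{q+\kappa+2})$, the functions $\mathcal Q_1(g,f)$ and $\mathcal Q_\alpha(g,f)$ exist and $$\|\mathcal Q_1(g,f)-\mathcal Q_\alpha(g,f)\|_{W^{k,2}_v(m_q)}\le c_{k,q}(\kappa)\,\frac{1-\alpha}{\alpha^a}\Big(\|f\|_{W^{k,2}_v(m_{q+\kappa+2})}\|g\|_{W^{k+1,2}_v(m_{q+\kappa+2})}+\|g\|_{W^{k,2}_v(m_{q+\kappa+2})}\|f\|_{W^{k+1,2}_v(m_{q+\kappa+2})}\Big).$$ The constants may depend on $d$ and $b$, but not on $\alpha$, $f$, $g$ or on the version of $\mathcal Q_\alpha$. -/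

import Mathlib

open MeasureTheory
open scoped ENNReal ContDiff RealInnerProductSpace

noncomputable section

namespace Granular

/-- The velocity space `ℝ^d` with its Euclidean norm. -/
abbrev Vel (d : ℕ) : Type := EuclideanSpace ℝ (Fin d)

/-- The unit sphere `S^{d-1}`. -/
abbrev Sph (d : ℕ) : Type := Metric.sphere (0 : Vel d) 1

/-- The surface (Lebesgue) measure `dσ` on the unit sphere. -/
def surface (d : ℕ) : Measure (Sph d) := (volume : Measure (Vel d)).toSphere

/-- The polynomial weight `m_s(v) = (1 + |v|²)^{s/2}`. -/
def weight {d : ℕ} (s : ℝ) (v : Vel d) : ℝ := (1 + ‖v‖ ^ 2) ^ (s / 2)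

/-- Smooth compactly supported real functions on `ℝ^d`. -/
def IsTest {d : ℕ} (φ : Vel d → ℝ) : Prop := ContDiff ℝ ∞ φ ∧ HasCompactSupport φ

/-! ### Weighted Sobolev spaces -/

/-- The classical partial derivative `∂_{I 0} ⋯ ∂_{I (j-1)} φ` along coordinate directions. -/
def partialDeriv {d j : ℕ} (I : Fin j → Fin d) (φ : Vel d → ℝ) (v : Vel d) : ℝ :=
  iteratedFDeriv ℝ j φ v (fun i => EuclideanSpace.single (I i) (1 : ℝ))

/-- `w` is the weak derivative `∂_{I 0} ⋯ ∂_{I (j-1)} f`. For `j = 0` this says `w = f` a.e. -/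
def IsWeakDeriv {d j : ℕ} (I : Fin j → Fin d) (f w : Vel d → ℝ) : Prop :=
  LocallyIntegrable f ∧ LocallyIntegrable w ∧
    ∀ φ : Vel d → ℝ, IsTest φ →
      ∫ v, f v * partialDeriv I φ v = (-1) ^ j * ∫ v, w v * φ v

/-- The length `|∇^j f(v)|` of the tensor of all `j`-th order derivatives at `v`, computed from a
family `D` in which `D I` is the derivative along `I`. -/
def tensorLength {d j : ℕ} (D : (Fin j → Fin d) → Vel d → ℝ) (v : Vel d) : ℝ :=
  Real.sqrt (∑ I : Fin j → Fin d, D I v ^ 2)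

/-- The norm of the weighted Sobolev space `W^{k,p}_v(m_s)`, namely
`∑_{j ≤ k} ‖ |∇^j f| m_s ‖_{L^p}`, where `∇^j f` are weak derivatives.
Weak derivatives are unique up to null sets, so the infimum is over one single value if `f`
has all weak derivatives up to order `k`, and it is `∞` if `f` has not. -/
def sobolevNorm {d : ℕ} (k : ℕ) (p : ℝ≥0∞) (s : ℝ) (f : Vel d → ℝ) : ℝ≥0∞ :=
  ⨅ (D : (j : ℕ) → (Fin j → Fin d) → Vel d → ℝ)
    (_ : ∀ j ≤ k, ∀ I : Fin j → Fin d, IsWeakDeriv I f (D j I)),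
    ∑ j ∈ Finset.range (k + 1), eLpNorm (fun v => tensorLength (D j) v * weight s v) p volume

/-- Membership in `W^{k,p}_v(m_s)`. -/
def MemSobolev {d : ℕ} (k : ℕ) (p : ℝ≥0∞) (s : ℝ) (f : Vel d → ℝ) : Prop :=
  sobolevNorm k p s f < ⊤

/-! ### The collision operator -/

/-- An angular kernel `b`: nonnegative on `[-1, 1]`, measurable, and normalised by
`∫_{S^{d-1}} b(σ · e) dσ = 1` for every unit vector `e`. -/
structure IsAngularKernel (d : ℕ) (b : ℝ → ℝ) : Prop where
  measurable : Measurable b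
  nonneg : ∀ x ∈ Set.Icc (-1 : ℝ) 1, 0 ≤ b x
  normalised : ∀ e : Sph d, ∫ σ : Sph d, b ⟪(σ : Vel d), (e : Vel d)⟫ ∂(surface d) = 1

/-- The unit vector `u / |u|` (its value at `u = 0` is irrelevant). -/
def unitVec {d : ℕ} (u : Vel d) : Vel d := ‖u‖⁻¹ • u

/-- `(1 + α)/4 (|u| σ - u)`, the change of velocity in a collision, where `u = v - v_*`. -/
def jump {d : ℕ} (α : ℝ) (u : Vel d) (σ : Sph d) : Vel d :=
  ((1 + α) / 4) • (‖u‖ • (σ : Vel d) - u)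

/-- The post-collisional velocity `v'`. -/
def post {d : ℕ} (α : ℝ) (v vs : Vel d) (σ : Sph d) : Vel d := v + jump α (v - vs) σ

/-- The post-collisional velocity `v_*'`. -/
def postStar {d : ℕ} (α : ℝ) (v vs : Vel d) (σ : Sph d) : Vel d := vs - jump α (v - vs) σ

/-- The two usual ways to read the bilinear operator `Q_α(g, f)` off the quadratic `Q_α(f, f)`:
the symmetric weak form, and the gain-minus-loss form `Q_α^+(g, f) - f ∫ g |v - v_*| dv_*`.
They coincide for `f = g`, and the first is the symmetrisation of the second. -/
inductive Form where
  | symmetric : Form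
  | gainLoss : Form

/-- The collisional increment of a test function `ψ`. -/
def increment {d : ℕ} (F : Form) (ψ : Vel d → ℝ) (v vs v' vs' : Vel d) : ℝ :=
  match F with
  | Form.symmetric => (1 / 2) * (ψ v' + ψ vs' - ψ v - ψ vs)
  | Form.gainLoss => ψ v' - ψ v

/-- The angular average of the increment over all outcomes of a collision of `v` and `v_*`. -/
def angularAverage {d : ℕ} (F : Form) (b : ℝ → ℝ) (α : ℝ) (ψ : Vel d → ℝ) (v vs : Vel d) : ℝ :=
  ∫ σ : Sph d, increment F ψ v vs (post α v vs σ) (postStar α v vs σ) *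
    b ⟪(σ : Vel d), unitVec (v - vs)⟫ ∂(surface d)

/-- `Q` is the function `Q_α(g, f)`, defined in weak form with hard-sphere kinetic factor
`|v - v_*|`, angular kernel `b` and restitution coefficient `α`. -/
def IsCollision {d : ℕ} (F : Form) (b : ℝ → ℝ) (α : ℝ) (g f Q : Vel d → ℝ) : Prop :=
  LocallyIntegrable Q ∧
    ∀ ψ : Vel d → ℝ, IsTest ψ →
      ∫ v, Q v * ψ v =
        ∫ v, ∫ vs, f v * g vs * ‖v - vs‖ * angularAverage F b α ψ v vs

end Granular

end

/-!
# Elastic limit of the collision operator in weighted Sobolev spaces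

For fixed relative velocity `u` and direction `σ`, the collision map `v ↦ v' = v + β w`, with
`w = |u| σ - u` and `β = (1 + α)/4`, is a *translation*. In the variables `(v, u, σ)` the gain
operator is therefore a superposition of translates,
`Q⁺(g, f)(v) = ∫∫ |u| b(σ·û) F_u(v - β w) dσ du` with `F_u(v) = f(v) g(v - u)`,
and no derivative ever falls on the angular kernel `b`, which is only integrable. Three consequences
prove the theorem.

* The difference for `β = 1/2` and `β = (1 + α)/4` is the integral over `β` of translates of
  `-w · ∇F_u`, over an interval of length `(1 - α)/4`, and `∇F_u` is given by the product rule
  (`gain_sub_gain_ae_eq`, `ae_leibniz`). This costs a factor `|u| |w| ≤ 2 |u|²` and no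
  negative power of `α`. The loss term does not depend on `α`.
* Operators of this translation type (`transfer`) are bounded from `L¹(m_{q+2})²` to `L¹(m_q)`,
  since `m_q(v')` and `|u|²` are both controlled by the weights at `v` and `v_*`. The bound from
  `L²(m_{q+κ+2})²` to `L²(m_q)` comes from Cauchy–Schwarz in `(u, σ)` with the
  weight `m_{-2κ-2}(u)` (`IsTransferKernel.eLpNorm_two_transfer_le`).
* By translation invariance `∂_i Q(g, f) = Q(∂_i g, f) + Q(g, ∂_i f)`, which lifts the estimate
  from order `0` to order `k` (`sobolevNorm_le_of_isLeibniz`).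

All integrations by parts are done on test functions. The product rule for `F_u` holds in the weak
sense for almost every `u`. The functions `f` and `g` are replaced by measurable representatives
of finite second moment throughout; both scales of Sobolev spaces provide this.
-/

noncomputable section

namespace Granular

/-! ### Weights -/

/-- The weight `m_s`, with values in `[0, ∞]`. -/
def eweight {d : ℕ} (s : ℝ) (v : Vel d) : ℝ≥0∞ := ENNReal.ofReal (weight s v)

section Weights

variable {d : ℕ}

lemma one_add_norm_sq_pos (v : Vel d) : 0 < 1 + ‖v‖ ^ 2 := by positivity

lemma weight_pos (s : ℝ) (v : Vel d) : 0 < weight s v :=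
  Real.rpow_pos_of_pos (one_add_norm_sq_pos v) _

lemma weight_add (s t : ℝ) (v : Vel d) : weight (s + t) v = weight s v * weight t v := by
  rw [weight, weight, weight, add_div, Real.rpow_add (one_add_norm_sq_pos v)]

lemma continuous_weight (s : ℝ) : Continuous (weight s : Vel d → ℝ) := by
  unfold weight
  exact (by fun_prop : Continuous fun v : Vel d => 1 + ‖v‖ ^ 2).rpow_const
    fun v => Or.inl (one_add_norm_sq_pos v).ne'

lemma weight_two (v : Vel d) : weight 2 v = 1 + ‖v‖ ^ 2 := by
  simp [weight]

lemma one_le_weight {s : ℝ} (hs : 0 ≤ s) (v : Vel d) : 1 ≤ weight s v :=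
  Real.one_le_rpow (by nlinarith [sq_nonneg ‖v‖]) (by positivity)

lemma weight_mono {s t : ℝ} (h : s ≤ t) (v : Vel d) : weight s v ≤ weight t v :=
  Real.rpow_le_rpow_of_exponent_le (by nlinarith [sq_nonneg ‖v‖]) (by linarith)

lemma weight_le_of_sq_le {s c : ℝ} (hs : 0 ≤ s) (hc : 0 ≤ c) {v x y : Vel d}
    (h : 1 + ‖v‖ ^ 2 ≤ c * ((1 + ‖x‖ ^ 2) * (1 + ‖y‖ ^ 2))) :
    weight s v ≤ c ^ (s / 2) * (weight s x * weight s y) := by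
  unfold weight
  rw [← Real.mul_rpow (by positivity) (by positivity), ← Real.mul_rpow hc (by positivity)]
  exact Real.rpow_le_rpow (by positivity) h (by positivity)

lemma weight_add_le {s : ℝ} (hs : 0 ≤ s) {x u z : Vel d} (hz : ‖z‖ ≤ ‖u‖) :
    weight s (x + z) ≤ 8 ^ (s / 2) * (weight s x * weight s (x - u)) := by
  refine weight_le_of_sq_le hs (by norm_num) ?_
  have h1 : ‖u‖ ≤ ‖x‖ + ‖x - u‖ := by
    simpa using norm_sub_le x (x - u)
  have h2 : ‖x + z‖ ≤ 2 * ‖x‖ + ‖x - u‖ := by linarith [norm_add_le x z]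
  nlinarith [sq_nonneg (2 * ‖x‖ - ‖x - u‖), norm_nonneg (x + z), norm_nonneg x,
    norm_nonneg (x - u), mul_nonneg (sq_nonneg ‖x‖) (sq_nonneg ‖x - u‖)]

lemma weight_le_sub {s : ℝ} (hs : 0 ≤ s) (x u : Vel d) :
    weight s u ≤ 2 ^ (s / 2) * (weight s x * weight s (x - u)) := by
  refine weight_le_of_sq_le hs (by norm_num) ?_
  have h1 : ‖u‖ ≤ ‖x‖ + ‖x - u‖ := by
    simpa using norm_sub_le x (x - u)
  nlinarith [sq_nonneg (‖x‖ - ‖x - u‖), norm_nonneg u, norm_nonneg x,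
    norm_nonneg (x - u), mul_nonneg (sq_nonneg ‖x‖) (sq_nonneg ‖x - u‖)]

@[fun_prop]
lemma measurable_eweight (s : ℝ) : Measurable (eweight s : Vel d → ℝ≥0∞) :=
  (continuous_weight s).measurable.ennreal_ofReal

lemma eweight_add (s t : ℝ) (v : Vel d) : eweight (s + t) v = eweight s v * eweight t v := by
  rw [eweight, weight_add, ENNReal.ofReal_mul (weight_pos s v).le]; rfl

lemma one_le_eweight {s : ℝ} (hs : 0 ≤ s) (v : Vel d) : 1 ≤ eweight s v := by
  simpa [eweight] using one_le_weight hs v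

lemma eweight_mono {s t : ℝ} (h : s ≤ t) (v : Vel d) : eweight s v ≤ eweight t v :=
  ENNReal.ofReal_le_ofReal (weight_mono h v)

lemma enorm_weight (s : ℝ) (v : Vel d) : ‖weight s v‖ₑ = eweight s v :=
  Real.enorm_of_nonneg (weight_pos s v).le

lemma eweight_add_le {s : ℝ} (hs : 0 ≤ s) {x u z : Vel d} (hz : ‖z‖ ≤ ‖u‖) :
    eweight s (x + z) ≤ ENNReal.ofReal (8 ^ (s / 2)) * (eweight s x * eweight s (x - u)) := by
  unfold eweight
  rw [← ENNReal.ofReal_mul (weight_pos s _).le, ← ENNReal.ofReal_mul (by positivity)]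
  exact ENNReal.ofReal_le_ofReal (weight_add_le hs hz)

lemma eweight_le_sub {s : ℝ} (hs : 0 ≤ s) (x u : Vel d) :
    eweight s u ≤ ENNReal.ofReal (2 ^ (s / 2)) * (eweight s x * eweight s (x - u)) := by
  unfold eweight
  rw [← ENNReal.ofReal_mul (weight_pos s _).le, ← ENNReal.ofReal_mul (by positivity)]
  exact ENNReal.ofReal_le_ofReal (weight_le_sub hs x u)

lemma eweight_neg_mul (s : ℝ) (v : Vel d) : eweight (-s) v * eweight s v = 1 := by
  rw [← eweight_add]; simp [eweight, weight]

lemma eweight_sq (s : ℝ) (v : Vel d) : eweight s v ^ 2 = eweight (2 * s) v := by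
  rw [sq, ← eweight_add, two_mul]

lemma lintegral_eweight_lt_top {s : ℝ} (hs : (d : ℝ) < s) :
    ∫⁻ v : Vel d, eweight (-s) v < ⊤ := by
  have h := integrable_rpow_neg_one_add_norm_sq (E := Vel d) (μ := volume) (r := s) (by simpa)
  have h2 := h.lintegral_lt_top
  simpa [eweight, weight] using h2

lemma lintegral_mul_sq_le {Ω : Type*} [MeasurableSpace Ω] (μ : Measure Ω) {x y : Ω → ℝ≥0∞}
    (hx : Measurable x) (hy : Measurable y) :
    (∫⁻ θ, x θ * y θ ∂μ) ^ 2 ≤ (∫⁻ θ, x θ ^ 2 ∂μ) * ∫⁻ θ, y θ ^ 2 ∂μ := by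
  have h := ENNReal.lintegral_mul_le_Lp_mul_Lq μ
    (Real.HolderConjugate.two_two) hx.aemeasurable hy.aemeasurable
  simp only [Pi.mul_apply, ENNReal.rpow_two] at h
  calc _ ≤ ((∫⁻ θ, x θ ^ 2 ∂μ) ^ (1 / 2 : ℝ) * (∫⁻ θ, y θ ^ 2 ∂μ) ^ (1 / 2 : ℝ)) ^ 2 := by
        gcongr
    _ = _ := by
        rw [mul_pow, ← ENNReal.rpow_natCast, ← ENNReal.rpow_natCast, ← ENNReal.rpow_mul,
          ← ENNReal.rpow_mul]
        norm_num

end Weights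

/-! ### Translation-type bilinear operators -/

section Bilinear

variable {d : ℕ} {Ω : Type*} [MeasurableSpace Ω]

/-- Data of a bilinear operator of collision type. The parameter `θ` of a collision determines the
relative velocity `U θ`, the displacement `Z θ` and the signed rate `κ θ`; the displacement is at
most the relative velocity, and the law of `U` under `|κ| dν` is at most `A (1 + |u|²) du`. -/
structure IsTransferKernel (ν : Measure Ω) (κ : Ω → ℝ) (U Z : Ω → Vel d) (A : ℝ≥0∞) : Prop where
  measurable_rate : Measurable κ
  measurable_rel : Measurable U
  measurable_shift : Measurable Z
  norm_shift_le : ∀ᵐ θ ∂ν, ‖Z θ‖ ≤ ‖U θ‖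
  lintegral_le : ∀ h : Vel d → ℝ≥0∞, Measurable h →
    ∫⁻ θ, ‖κ θ‖ₑ * h (U θ) ∂ν ≤ A * ∫⁻ u, eweight 2 u * h u

/-- The bilinear operator `v ↦ ∫ κ f(v - Z) g(v - Z - U) dν`: a superposition over `θ` of
translates of the functions `v ↦ f(v) g(v - U θ)`. -/
def transfer (ν : Measure Ω) (κ : Ω → ℝ) (U Z : Ω → Vel d) (f g : Vel d → ℝ) (v : Vel d) : ℝ :=
  ∫ θ, κ θ * (f (v - Z θ) * g (v - Z θ - U θ)) ∂ν

variable {ν : Measure Ω} {κ : Ω → ℝ} {U Z : Ω → Vel d} {A : ℝ≥0∞}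

namespace IsTransferKernel

/-- The weighted bound behind all estimates: after a translation in `v`, the weight at the
shifted point and the one at the relative velocity are both absorbed by the weights
at `v` and `v - U`. -/
lemma lintegral_weighted_le [SFinite ν] (hK : IsTransferKernel ν κ U Z A) {s t : ℝ}
    (hs : 0 ≤ s + 2) (ht : 0 ≤ t) {F G : Vel d → ℝ≥0∞} (hF : Measurable F) (hG : Measurable G) :
    ∫⁻ v, (∫⁻ θ, ‖κ θ‖ₑ * (eweight s (U θ) * (F (v - Z θ) * G (v - Z θ - U θ))) ∂ν)
        * eweight t v ≤
      A * (ENNReal.ofReal (8 ^ (t / 2)) * ENNReal.ofReal (2 ^ ((s + 2) / 2))) *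
        ((∫⁻ v, F v * eweight (t + (s + 2)) v) * ∫⁻ v, G v * eweight (t + (s + 2)) v) := by
  have hκ := hK.measurable_rate
  have hU := hK.measurable_rel
  have hZ := hK.measurable_shift
  set C := ENNReal.ofReal (8 ^ (t / 2))
  set C' := ENNReal.ofReal (2 ^ ((s + 2) / 2))
  set F' : Vel d → ℝ≥0∞ := fun x => F x * eweight t x with hF'
  set G' : Vel d → ℝ≥0∞ := fun x => G x * eweight t x with hG'
  have hF'm : Measurable F' := by fun_prop
  have hG'm : Measurable G' := by fun_prop
  have hm1 : Measurable fun u => ∫⁻ x, F' x * G' (x - u) :=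
    Measurable.lintegral_prod_left' (f := fun p : Vel d × Vel d => F' p.1 * G' (p.1 - p.2))
      (by fun_prop)
  calc _ = ∫⁻ v, ∫⁻ θ, ‖κ θ‖ₑ * (eweight s (U θ) * (F (v - Z θ) * G (v - Z θ - U θ)))
            * eweight t v ∂ν := by
        refine lintegral_congr fun v => ?_
        rw [lintegral_mul_const]
        fun_prop
    _ = ∫⁻ θ, ∫⁻ v, ‖κ θ‖ₑ * (eweight s (U θ) * (F (v - Z θ) * G (v - Z θ - U θ)))
            * eweight t v ∂volume ∂ν := by
        rw [lintegral_lintegral_swap]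
        refine Measurable.aemeasurable ?_
        unfold Function.uncurry
        fun_prop
    _ = ∫⁻ θ, ∫⁻ x, ‖κ θ‖ₑ * (eweight s (U θ) * (F x * G (x - U θ)))
            * eweight t (x + Z θ) ∂volume ∂ν := by
        refine lintegral_congr fun θ => ?_
        rw [← lintegral_sub_right_eq_self (fun x => ‖κ θ‖ₑ * (eweight s (U θ) *
          (F x * G (x - U θ))) * eweight t (x + Z θ)) (Z θ)]
        simp only [sub_add_cancel]
    _ ≤ ∫⁻ θ, ‖κ θ‖ₑ * (eweight s (U θ) * (C * ∫⁻ x, F' x * G' (x - U θ))) ∂ν := by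
        refine lintegral_mono_ae ?_
        filter_upwards [hK.norm_shift_le] with θ hθ
        rw [← lintegral_const_mul _ (by fun_prop), ← lintegral_const_mul _ (by fun_prop),
          ← lintegral_const_mul _ (by fun_prop)]
        refine lintegral_mono fun x => ?_
        calc _ ≤ ‖κ θ‖ₑ * (eweight s (U θ) * (F x * G (x - U θ)))
            * (C * (eweight t x * eweight t (x - U θ))) := by
              gcongr
              exact eweight_add_le ht hθ
          _ = _ := by simp only [hF', hG']; ring
    _ ≤ A * ∫⁻ u, eweight 2 u * (eweight s u * (C * ∫⁻ x, F' x * G' (x - u))) :=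
        hK.lintegral_le (fun u => eweight s u * (C * ∫⁻ x, F' x * G' (x - u))) (by fun_prop)
    _ ≤ A * ∫⁻ u, ∫⁻ x, (C * C') * ((F x * eweight (t + (s + 2)) x) *
          (G (x - u) * eweight (t + (s + 2)) (x - u))) := by
        gcongr with u
        rw [← lintegral_const_mul _ (by fun_prop), ← lintegral_const_mul _ (by fun_prop),
          ← lintegral_const_mul _ (by fun_prop)]
        refine lintegral_mono fun x => ?_
        calc _ = C * (F' x * G' (x - u)) * eweight (s + 2) u := by rw [eweight_add]; ring
          _ ≤ C * (F' x * G' (x - u)) *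
              (C' * (eweight (s + 2) x * eweight (s + 2) (x - u))) := by
              gcongr
              exact eweight_le_sub hs x u
          _ = _ := by
              simp only [hF', hG']
              rw [eweight_add t (s + 2), eweight_add t (s + 2)]; ring
    _ = A * ((C * C') * ∫⁻ x, (F x * eweight (t + (s + 2)) x) *
          ∫⁻ u, (G (x - u) * eweight (t + (s + 2)) (x - u))) := by
        rw [lintegral_lintegral_swap (by
          refine Measurable.aemeasurable ?_
          unfold Function.uncurry
          fun_prop)]
        congr 1
        rw [← lintegral_const_mul']
        · refine lintegral_congr fun x => ?_
          rw [← lintegral_const_mul _ (by fun_prop), ← lintegral_const_mul _ (by fun_prop)]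
        · exact ENNReal.mul_ne_top ENNReal.ofReal_ne_top ENNReal.ofReal_ne_top
    _ = _ := by
        have : ∀ x, ∫⁻ u, (G (x - u) * eweight (t + (s + 2)) (x - u)) =
            ∫⁻ u, (G u * eweight (t + (s + 2)) u) := fun x =>
          lintegral_sub_left_eq_self (fun u => G u * eweight (t + (s + 2)) u) x
        simp_rw [this]
        rw [lintegral_mul_const _ (by fun_prop)]
        ring

lemma measurable_transfer [SFinite ν] (hK : IsTransferKernel ν κ U Z A) {f g : Vel d → ℝ}
    (hf : Measurable f) (hg : Measurable g) : Measurable (transfer ν κ U Z f g) := by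
  have hκ := hK.measurable_rate
  have hU := hK.measurable_rel
  have hZ := hK.measurable_shift
  have : StronglyMeasurable (fun p : Vel d × Ω =>
    κ p.2 * (f (p.1 - Z p.2) * g (p.1 - Z p.2 - U p.2))) :=
    Measurable.stronglyMeasurable (by fun_prop)
  exact this.integral_prod_right.measurable

lemma enorm_transfer_le (f g : Vel d → ℝ) (v : Vel d) : ‖transfer ν κ U Z f g v‖ₑ ≤
    ∫⁻ θ, ‖κ θ‖ₑ * (‖f (v - Z θ)‖ₑ * ‖g (v - Z θ - U θ)‖ₑ) ∂ν := by
  refine (enorm_integral_le_lintegral_enorm _).trans_eq (lintegral_congr fun θ => ?_)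
  rw [enorm_mul, enorm_mul]

lemma eLpNorm_one_transfer_le [SFinite ν] (hK : IsTransferKernel ν κ U Z A) {q : ℝ} (hq : 0 ≤ q)
    {f g : Vel d → ℝ} (hf : Measurable f) (hg : Measurable g) :
    eLpNorm (fun v => transfer ν κ U Z f g v * weight q v) 1 volume ≤
      A * ENNReal.ofReal (8 ^ (q / 2) * 2) *
        (eLpNorm (fun v => f v * weight (q + 2) v) 1 volume *
          eLpNorm (fun v => g v * weight (q + 2) v) 1 volume) := by
  simp only [eLpNorm_one_eq_lintegral_enorm, enorm_mul, enorm_weight]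
  have h := hK.lintegral_weighted_le (s := 0) (by norm_num) hq hf.enorm hg.enorm
  have h0 : ∀ v : Vel d, eweight 0 v = 1 := fun v => by simp [eweight, weight]
  simp only [h0, one_mul, zero_add] at h
  refine (lintegral_mono fun v => ?_).trans (h.trans_eq ?_)
  · gcongr
    exact enorm_transfer_le f g v
  · rw [ENNReal.ofReal_mul (by positivity)]; norm_num

/-- Cauchy–Schwarz in `θ` with the weight `m_{-2r-2}(U)` reduces the `L²` bound to
`lintegral_weighted_le`. The total mass of this weight under `|κ| dν` is at most
`A ∫ m_{-2r}(u) du`, which is finite for `2r > d`. -/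
lemma eLpNorm_two_transfer_le [SFinite ν] (hK : IsTransferKernel ν κ U Z A) {q r : ℝ}
    (hq : 0 ≤ q) (hr : 0 ≤ r) {f g : Vel d → ℝ} (hf : Measurable f) (hg : Measurable g) :
    eLpNorm (fun v => transfer ν κ U Z f g v * weight q v) 2 volume ≤
      A * ((∫⁻ u : Vel d, eweight (-(2 * r)) u) *
          ENNReal.ofReal (8 ^ q * 2 ^ (r + 2))) ^ (1 / 2 : ℝ) *
        (eLpNorm (fun v => f v * weight (q + r + 2) v) 2 volume *
          eLpNorm (fun v => g v * weight (q + r + 2) v) 2 volume) := by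
  have hκ := hK.measurable_rate
  have hU := hK.measurable_rel
  have hZ := hK.measurable_shift
  have hL2 : ∀ h : Vel d → ℝ, eLpNorm h 2 volume = (∫⁻ v, ‖h v‖ₑ ^ 2) ^ (1 / 2 : ℝ) := fun h => by
    rw [eLpNorm_eq_lintegral_rpow_enorm_toReal (by norm_num) (by norm_num)]; simp
  have h1 := hK.lintegral_weighted_le (s := 2 * r + 2) (t := 2 * q) (by linarith) (by linarith)
    (hf.enorm.pow_const 2) (hg.enorm.pow_const 2)
  have hmass : ∫⁻ θ, ‖κ θ‖ₑ * eweight (-(2 * r + 2)) (U θ) ∂ν ≤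
      A * ∫⁻ u : Vel d, eweight (-(2 * r)) u := by
    refine (hK.lintegral_le (eweight (-(2 * r + 2))) (by fun_prop)).trans_eq ?_
    simp_rw [← eweight_add]
    congr! 4
    ring
  have hpt : ∀ v, ‖transfer ν κ U Z f g v * weight q v‖ₑ ^ 2 ≤
      (A * ∫⁻ u : Vel d, eweight (-(2 * r)) u) *
      ((∫⁻ θ, ‖κ θ‖ₑ * (eweight (2 * r + 2) (U θ) *
        (‖f (v - Z θ)‖ₑ ^ 2 * ‖g (v - Z θ - U θ)‖ₑ ^ 2)) ∂ν) * eweight (2 * q) v) := by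
    intro v
    rw [enorm_mul, mul_pow, enorm_weight, eweight_sq, ← mul_assoc]
    gcongr
    have hcs := lintegral_mul_sq_le ν
      (x := fun θ => (‖κ θ‖ₑ * eweight (-(2 * r + 2)) (U θ)) ^ (1 / 2 : ℝ))
      (y := fun θ => (‖κ θ‖ₑ * eweight (2 * r + 2) (U θ)) ^ (1 / 2 : ℝ) *
        (‖f (v - Z θ)‖ₑ * ‖g (v - Z θ - U θ)‖ₑ)) (by fun_prop) (by fun_prop)
    have hsq : ∀ x : ℝ≥0∞, (x ^ (1 / 2 : ℝ)) ^ 2 = x := fun x => by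
      rw [← ENNReal.rpow_natCast, ← ENNReal.rpow_mul]; norm_num
    calc ‖transfer ν κ U Z f g v‖ₑ ^ 2
        ≤ (∫⁻ θ, ‖κ θ‖ₑ * (‖f (v - Z θ)‖ₑ * ‖g (v - Z θ - U θ)‖ₑ) ∂ν) ^ 2 := by
          gcongr; exact enorm_transfer_le f g v
      _ = _ := by
          congr 1
          refine lintegral_congr fun θ => ?_
          rw [← mul_assoc ((‖κ θ‖ₑ * eweight (-(2 * r + 2)) (U θ)) ^ (1 / 2 : ℝ)),
            ← ENNReal.mul_rpow_of_nonneg _ _ (by norm_num)]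
          congr 1
          calc ‖κ θ‖ₑ = ((‖κ θ‖ₑ) ^ 2) ^ (1 / 2 : ℝ) := by
                rw [← ENNReal.rpow_natCast, ← ENNReal.rpow_mul]; norm_num
            _ = (‖κ θ‖ₑ ^ 2 * (eweight (-(2 * r + 2)) (U θ) * eweight (2 * r + 2) (U θ)))
                  ^ (1 / 2 : ℝ) := by rw [eweight_neg_mul, mul_one]
            _ = _ := by congr 1; ring
      _ ≤ _ := hcs
      _ ≤ _ := by
          simp only [mul_pow, hsq]
          refine (mul_le_mul_left hmass _).trans_eq ?_
          congr 1
          refine lintegral_congr fun θ => ?_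
          ring
  rw [hL2, hL2, hL2, ← ENNReal.mul_rpow_of_nonneg _ _ (by norm_num)]
  have hA : A = (A ^ 2) ^ (1 / 2 : ℝ) := by
    rw [← ENNReal.rpow_natCast, ← ENNReal.rpow_mul]; norm_num
  rw [hA, ← ENNReal.mul_rpow_of_nonneg _ _ (by norm_num),
    ← ENNReal.mul_rpow_of_nonneg _ _ (by norm_num)]
  refine ENNReal.rpow_le_rpow ?_ (by norm_num)
  have hw : ∀ h : Vel d → ℝ, ∫⁻ v, ‖h v * weight (q + r + 2) v‖ₑ ^ 2 =
      ∫⁻ v, ‖h v‖ₑ ^ 2 * eweight (2 * q + (2 * r + 2 + 2)) v := fun h => by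
    refine lintegral_congr fun v => ?_
    rw [enorm_mul, mul_pow, enorm_weight, eweight_sq]
    congr 2; ring
  rw [hw, hw]
  refine (lintegral_mono hpt).trans ?_
  rw [lintegral_const_mul _ (by fun_prop)]
  refine (mul_le_mul_right h1 _).trans_eq ?_
  rw [ENNReal.ofReal_mul (by positivity), show 2 * q / 2 = q by ring,
    show (2 * r + 2 + 2) / 2 = r + 2 by ring]
  ring

end IsTransferKernel

end Bilinear

/-! ### Test functions -/

/-- The partial derivative `∂_i φ`. -/
def coordDeriv {d : ℕ} (i : Fin d) (φ : Vel d → ℝ) (v : Vel d) : ℝ :=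
  fderiv ℝ φ v (EuclideanSpace.single i 1)

section Test

variable {d : ℕ}

namespace IsTest

variable {φ ψ : Vel d → ℝ}

lemma continuous (h : IsTest φ) : Continuous φ := h.1.continuous

lemma differentiable (h : IsTest φ) : Differentiable ℝ φ := h.1.differentiable (by simp)

lemma isTest_coordDeriv (h : IsTest φ) (i : Fin d) : IsTest (coordDeriv i φ) :=
  ⟨(h.1.fderiv_right (m := ∞) (by simp)).clm_apply contDiff_const,
    (h.2.fderiv (𝕜 := ℝ)).comp_left (g := fun L : Vel d →L[ℝ] ℝ => L (EuclideanSpace.single i 1))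
      (by simp)⟩

lemma exists_bound (h : IsTest φ) : ∃ C, ∀ v, |φ v| ≤ C := by
  simpa using h.continuous.bounded_above_of_compact_support h.2

lemma comp_add_right (h : IsTest φ) (z : Vel d) : IsTest fun v => φ (v + z) :=
  ⟨h.1.comp (contDiff_id.add contDiff_const), h.2.comp_homeomorph (Homeomorph.addRight z)⟩

lemma comp_sub_left (h : IsTest φ) (z : Vel d) : IsTest fun v => φ (z - v) :=
  ⟨h.1.comp (contDiff_const.sub contDiff_id), h.2.comp_homeomorph (Homeomorph.subLeft z)⟩

lemma mul (h : IsTest φ) (h' : IsTest ψ) : IsTest fun v => φ v * ψ v :=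
  ⟨h.1.mul h'.1, h.2.mul_right⟩

end IsTest

lemma coordDeriv_comp_add_right (i : Fin d) (φ : Vel d → ℝ) (z v : Vel d) :
    coordDeriv i (fun v => φ (v + z)) v = coordDeriv i φ (v + z) := by
  simp [coordDeriv, fderiv_comp_add_right]

lemma coordDeriv_comp_sub_left (i : Fin d) {φ : Vel d → ℝ} (hφ : IsTest φ) (z v : Vel d) :
    coordDeriv i (fun v => φ (z - v)) v = -coordDeriv i φ (z - v) := by
  have h := ((hφ.differentiable (z - v)).hasFDerivAt.comp v ((hasFDerivAt_id v).const_sub z)).fderiv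
  have h' : fderiv ℝ (fun v => φ (z - v)) v = _ := h
  simp [coordDeriv, h']

lemma coordDeriv_mul {φ ψ : Vel d → ℝ} (hφ : IsTest φ) (hψ : IsTest ψ) (i : Fin d) (v : Vel d) :
    coordDeriv i (fun v => φ v * ψ v) v = φ v * coordDeriv i ψ v + coordDeriv i φ v * ψ v := by
  simp only [coordDeriv]
  rw [fderiv_fun_mul (hφ.differentiable v) (hψ.differentiable v)]
  simp [mul_comm]

end Test

/-! ### The product rule for almost every relative velocity -/

section Leibniz

variable {d : ℕ} {f g f' g' : Vel d → ℝ}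

/-- `f'` is a weak partial derivative `∂_i f`. -/
def IsWeakPartial (i : Fin d) (f f' : Vel d → ℝ) : Prop :=
  ∀ φ, IsTest φ → ∫ v, f v * coordDeriv i φ v = -∫ v, f' v * φ v

lemma integrable_mul_mul_of_bounded {α : Type*} [MeasurableSpace α] {μ : Measure α} {h χ : α → ℝ}
    (hh : Integrable h μ) (hχ : AEStronglyMeasurable χ μ) {C : ℝ} (hC : ∀ x, |χ x| ≤ C) :
    Integrable (fun x => h x * χ x) μ :=
  hh.mul_bdd (c := C) hχ (Filter.Eventually.of_forall hC)

lemma integrable_prod_test (hf : Integrable f) (hg : Integrable g) {ρ χ : Vel d → ℝ}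
    (hρ : IsTest ρ) (hχ : IsTest χ) :
    Integrable fun p : Vel d × Vel d => f p.1 * g p.2 * (ρ (p.1 - p.2) * χ p.1) := by
  obtain ⟨C, hC⟩ := hρ.exists_bound
  obtain ⟨C', hC'⟩ := hχ.exists_bound
  have := hρ.continuous
  have := hχ.continuous
  refine integrable_mul_mul_of_bounded (C := C * C') (hf.mul_prod hg)
    (Continuous.aestronglyMeasurable (by fun_prop)) fun p => ?_
  rw [abs_mul]
  exact mul_le_mul (hC _) (hC' _) (abs_nonneg _) ((abs_nonneg _).trans (hC 0))

lemma integrable_mul_sub (hf : Integrable f) (hg : Integrable g) :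
    Integrable fun p : Vel d × Vel d => f p.2 * g (p.2 - p.1) := by
  have := hf.convolution_integrand (ContinuousLinearMap.mul ℝ ℝ) hg.comp_neg
  simpa [Measure.volume_eq_prod] using this

lemma integrable_mul_sub_test (hf : Integrable f) (hg : Integrable g) {χ : Vel d → ℝ}
    (hχ : IsTest χ) :
    Integrable fun p : Vel d × Vel d => f p.2 * g (p.2 - p.1) * χ p.2 := by
  obtain ⟨C', hC'⟩ := hχ.exists_bound
  have := hχ.continuous
  exact integrable_mul_mul_of_bounded (integrable_mul_sub hf hg)
    (Continuous.aestronglyMeasurable (by fun_prop)) fun p => hC' _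

lemma integral_test_mul_sub (hf : Integrable f) (hg : Integrable g) {ρ χ : Vel d → ℝ}
    (hρ : IsTest ρ) (hχ : IsTest χ) :
    ∫ u, ρ u * ∫ v, f v * g (v - u) * χ v =
      ∫ p : Vel d × Vel d, f p.1 * g p.2 * (ρ (p.1 - p.2) * χ p.1) := by
  obtain ⟨C, hC⟩ := hρ.exists_bound
  have := hρ.continuous
  have hint : Integrable (Function.uncurry fun u v => ρ u * (f v * g (v - u) * χ v))
      (volume.prod volume) := by
    refine (integrable_mul_mul_of_bounded (integrable_mul_sub_test hf hg hχ)
      (χ := fun p : Vel d × Vel d => ρ p.1) (Continuous.aestronglyMeasurable (by fun_prop))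
      fun p => hC _).congr (Filter.Eventually.of_forall fun p => ?_)
    simp only [Function.uncurry]; ring
  calc _ = ∫ u, ∫ v, ρ u * (f v * g (v - u) * χ v) := by simp_rw [integral_const_mul]
    _ = ∫ v, ∫ u, ρ u * (f v * g (v - u) * χ v) := integral_integral_swap hint
    _ = ∫ v, ∫ y, f v * g y * (ρ (v - y) * χ v) := by
        refine integral_congr_ae (Filter.Eventually.of_forall fun v => ?_)
        simp only
        rw [← integral_sub_left_eq_self (fun y => f v * g y * (ρ (v - y) * χ v)) volume v]
        refine integral_congr_ae (Filter.Eventually.of_forall fun u => ?_)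
        simp only [sub_sub_cancel]; ring
    _ = _ := (integral_prod _ (integrable_prod_test hf hg hρ hχ)).symm

/-- Tested against `ρ(u) ψ(v)`, the product rule splits: in the variables `v` and `y = v - u`
it is one integration by parts in `v` for fixed `y`, and one in `y` for fixed `v`. -/
lemma ae_leibniz_aux {i : Fin d} (hf : Integrable f) (hg : Integrable g) (hf' : Integrable f')
    (hg' : Integrable g') (hff : IsWeakPartial i f f') (hgg : IsWeakPartial i g g')
    {ψ : Vel d → ℝ} (hψ : IsTest ψ) :
    ∀ᵐ u, (∫ v, f v * g (v - u) * coordDeriv i ψ v) +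
      ((∫ v, f' v * g (v - u) * ψ v) + ∫ v, f v * g' (v - u) * ψ v) = 0 := by
  have i1 : Integrable fun u => ∫ v, f v * g (v - u) * coordDeriv i ψ v :=
    (integrable_mul_sub_test hf hg (hψ.isTest_coordDeriv i)).integral_prod_left
  have i2 : Integrable fun u => ∫ v, f' v * g (v - u) * ψ v :=
    (integrable_mul_sub_test hf' hg hψ).integral_prod_left
  have i3 : Integrable fun u => ∫ v, f v * g' (v - u) * ψ v :=
    (integrable_mul_sub_test hf hg' hψ).integral_prod_left
  refine ae_eq_zero_of_integral_contDiff_smul_eq_zero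
    (i1.add (i2.add i3)).locallyIntegrable fun ρ hρ hρc => ?_
  have hT : IsTest ρ := ⟨hρ, hρc⟩
  obtain ⟨C, hC⟩ := hT.exists_bound
  have hm := hT.continuous.aestronglyMeasurable (μ := (volume : Measure (Vel d)))
  have j : ∀ {h : Vel d → ℝ}, Integrable h → Integrable fun u => ρ u * h u := fun hh =>
    hh.bdd_mul hm (Filter.Eventually.of_forall hC)
  have j23 : Integrable fun u => ρ u * (∫ v, f' v * g (v - u) * ψ v) +
      ρ u * ∫ v, f v * g' (v - u) * ψ v := (j i2).add (j i3)
  simp only [smul_eq_mul, mul_add]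
  rw [integral_add (j i1) j23, integral_add (j i2) (j i3),
    integral_test_mul_sub hf hg hT (hψ.isTest_coordDeriv i), integral_test_mul_sub hf' hg hT hψ,
    integral_test_mul_sub hf hg' hT hψ]
  have k1 := integrable_prod_test hf hg hT (hψ.isTest_coordDeriv i)
  have k2 := integrable_prod_test hf hg (hT.isTest_coordDeriv i) hψ
  have k3 := integrable_prod_test hf' hg hT hψ
  have k4 := integrable_prod_test hf hg' hT hψ
  have e1 : (∫ p : Vel d × Vel d, f p.1 * g p.2 * (ρ (p.1 - p.2) * coordDeriv i ψ p.1)) +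
      (∫ p : Vel d × Vel d, f p.1 * g p.2 * (coordDeriv i ρ (p.1 - p.2) * ψ p.1)) =
      -∫ p : Vel d × Vel d, f' p.1 * g p.2 * (ρ (p.1 - p.2) * ψ p.1) := by
    rw [← integral_add k1 k2]
    have k12 : Integrable fun p : Vel d × Vel d =>
      f p.1 * g p.2 * (ρ (p.1 - p.2) * coordDeriv i ψ p.1) +
      f p.1 * g p.2 * (coordDeriv i ρ (p.1 - p.2) * ψ p.1) := k1.add k2
    simp only [Measure.volume_eq_prod] at k12 k3 ⊢
    rw [integral_prod_symm _ k12, integral_prod_symm _ k3, ← integral_neg]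
    refine integral_congr_ae (Filter.Eventually.of_forall fun y => ?_)
    have hty : IsTest fun v => ρ (v - y) := by
      simpa [sub_eq_add_neg] using hT.comp_add_right (-y)
    have hd : ∀ v, coordDeriv i (fun v => ρ (v - y)) v = coordDeriv i ρ (v - y) := fun v => by
      simpa [sub_eq_add_neg] using coordDeriv_comp_add_right i ρ (-y) v
    have h := congrArg (g y * ·) (hff _ (hty.mul hψ))
    simp only [coordDeriv_mul hty hψ, hd] at h
    rw [mul_neg, ← integral_const_mul, ← integral_const_mul] at h
    refine (integral_congr_ae (Filter.Eventually.of_forall fun v => ?_)).trans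
      (h.trans (congrArg Neg.neg (integral_congr_ae (Filter.Eventually.of_forall fun v => ?_))))
    all_goals simp only; ring
  have e2 : (∫ p : Vel d × Vel d, f p.1 * g p.2 * (coordDeriv i ρ (p.1 - p.2) * ψ p.1)) =
      ∫ p : Vel d × Vel d, f p.1 * g' p.2 * (ρ (p.1 - p.2) * ψ p.1) := by
    simp only [Measure.volume_eq_prod] at k2 k4 ⊢
    rw [integral_prod _ k2, integral_prod _ k4]
    refine integral_congr_ae (Filter.Eventually.of_forall fun v => ?_)
    have h := congrArg (fun x => -(f v * ψ v * x)) (hgg _ (hT.comp_sub_left v))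
    simp only [coordDeriv_comp_sub_left i hT, mul_neg, integral_neg, neg_neg] at h
    rw [← integral_const_mul, ← integral_const_mul] at h
    refine (integral_congr_ae (Filter.Eventually.of_forall fun y => ?_)).trans
      (h.trans (integral_congr_ae (Filter.Eventually.of_forall fun y => ?_)))
    all_goals simp only; ring
  linarith

lemma continuous_integral_mul_comp_add {h χ : Vel d → ℝ} (hh : Integrable h) (hχ : IsTest χ) :
    Continuous fun z => ∫ v, h v * χ (v + z) := by
  obtain ⟨C, hC⟩ := hχ.exists_bound
  have := hχ.continuous
  refine continuous_of_dominated (bound := fun v => |h v| * C) (fun z => ?_)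
    (fun z => Filter.Eventually.of_forall fun v => ?_) (hh.abs.mul_const C)
    (Filter.Eventually.of_forall fun v => by fun_prop)
  · exact hh.aestronglyMeasurable.mul (Continuous.aestronglyMeasurable (by fun_prop))
  · rw [Real.norm_eq_abs, abs_mul]
    exact mul_le_mul_of_nonneg_left (hC _) (abs_nonneg _)

/-- The product rule for `v ↦ f(v) g(v - u)`, tested against all translates of `ψ` with a
single exceptional null set of `u`. Both sides are continuous in the translation `z`, so it is
enough to have them agree for `z` in a countable dense set. -/
lemma ae_leibniz {i : Fin d} (hf : Integrable f) (hg : Integrable g) (hf' : Integrable f')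
    (hg' : Integrable g') (hff : IsWeakPartial i f f') (hgg : IsWeakPartial i g g')
    {ψ : Vel d → ℝ} (hψ : IsTest ψ) :
    ∀ᵐ u, ∀ z, (∫ v, f v * g (v - u) * coordDeriv i ψ (v + z)) =
      -((∫ v, f' v * g (v - u) * ψ (v + z)) + ∫ v, f v * g' (v - u) * ψ (v + z)) := by
  have h1 : ∀ᵐ u, ∀ n : ℕ, (∫ v, f v * g (v - u) *
      coordDeriv i (fun v => ψ (v + TopologicalSpace.denseSeq (Vel d) n)) v) +
      ((∫ v, f' v * g (v - u) * ψ (v + TopologicalSpace.denseSeq (Vel d) n)) +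
        ∫ v, f v * g' (v - u) * ψ (v + TopologicalSpace.denseSeq (Vel d) n)) = 0 :=
    ae_all_iff.2 fun n => ae_leibniz_aux hf hg hf' hg' hff hgg (hψ.comp_add_right _)
  filter_upwards [h1, (integrable_mul_sub hf hg).prod_right_ae,
    (integrable_mul_sub hf' hg).prod_right_ae, (integrable_mul_sub hf hg').prod_right_ae]
    with u hu j1 j2 j3
  have c1 := continuous_integral_mul_comp_add j1 (hψ.isTest_coordDeriv i)
  have c2 := continuous_integral_mul_comp_add j2 hψ
  have c3 := continuous_integral_mul_comp_add j3 hψ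
  refine congrFun (c1.ext_on (TopologicalSpace.denseRange_denseSeq (Vel d)) (c2.add c3).neg ?_)
  rintro _ ⟨n, rfl⟩
  have := hu n
  simp only [coordDeriv_comp_add_right] at this
  linarith

end Leibniz

/-! ### Weak form and weak derivatives of the bilinear operators -/

section TransferWeak

lemma integral_shift {d : ℕ} {Ω : Type*} (f g ψ : Vel d → ℝ) (κ : Ω → ℝ) (U Z : Ω → Vel d) (θ : Ω) :
    ∫ v, κ θ * (f (v - Z θ) * g (v - Z θ - U θ)) * ψ v =
      κ θ * ∫ x, f x * g (x - U θ) * ψ (x + Z θ) := by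
  rw [← integral_const_mul, ← integral_sub_right_eq_self
    (fun x => κ θ * (f x * g (x - U θ) * ψ (x + Z θ))) (Z θ)]
  simp only [sub_add_cancel, mul_assoc]

variable {d : ℕ} {Ω : Type*} [MeasurableSpace Ω] {ν : Measure Ω} {κ : Ω → ℝ} {U Z : Ω → Vel d}
  {A : ℝ≥0∞} {f g f' g' : Vel d → ℝ}

/-- A measurable function with finite second moment `∫ |f| (1 + |v|²) dv`. -/
structure HasSecondMoment (f : Vel d → ℝ) : Prop where
  measurable : Measurable f
  lintegral_lt_top : ∫⁻ v, ‖f v‖ₑ * eweight 2 v < ⊤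

lemma HasSecondMoment.integrable (hf : HasSecondMoment f) : Integrable f := by
  refine ⟨hf.measurable.aestronglyMeasurable, lt_of_le_of_lt (lintegral_mono fun v => ?_)
    hf.lintegral_lt_top⟩
  exact le_mul_of_one_le_right' (one_le_eweight (by norm_num) v)

namespace IsTransferKernel

lemma integrable_prod [SFinite ν] (hK : IsTransferKernel ν κ U Z A) (hA : A ≠ ⊤)
    (hf : HasSecondMoment f) (hg : HasSecondMoment g) :
    Integrable (fun p : Vel d × Ω => κ p.2 * (f (p.1 - Z p.2) * g (p.1 - Z p.2 - U p.2)))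
      (volume.prod ν) := by
  have hκ := hK.measurable_rate
  have hU := hK.measurable_rel
  have hZ := hK.measurable_shift
  have hfm := hf.measurable
  have hgm := hg.measurable
  refine ⟨Measurable.aestronglyMeasurable (by fun_prop), ?_⟩
  unfold HasFiniteIntegral
  rw [lintegral_prod _ (Measurable.aemeasurable (by fun_prop))]
  have h := hK.lintegral_weighted_le (s := 0) (t := 0) (by norm_num) le_rfl hfm.enorm hgm.enorm
  have h0 : ∀ v : Vel d, eweight 0 v = 1 := fun v => by simp [eweight, weight]
  simp only [h0, one_mul, zero_add, mul_one] at h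
  simp only [enorm_mul]
  refine h.trans_lt ?_
  refine ENNReal.mul_lt_top (ENNReal.mul_lt_top hA.lt_top ?_)
    (ENNReal.mul_lt_top hf.lintegral_lt_top hg.lintegral_lt_top)
  exact ENNReal.mul_lt_top ENNReal.ofReal_lt_top ENNReal.ofReal_lt_top

lemma integrable_transfer [SFinite ν] (hK : IsTransferKernel ν κ U Z A) (hA : A ≠ ⊤)
    (hf : HasSecondMoment f) (hg : HasSecondMoment g) : Integrable (transfer ν κ U Z f g) :=
  (hK.integrable_prod hA hf hg).integral_prod_left

lemma integrable_prod_mul [SFinite ν] (hK : IsTransferKernel ν κ U Z A) (hA : A ≠ ⊤)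
    (hf : HasSecondMoment f) (hg : HasSecondMoment g) {ψ : Vel d → ℝ} (hψ : IsTest ψ) :
    Integrable (fun p : Vel d × Ω =>
      κ p.2 * (f (p.1 - Z p.2) * g (p.1 - Z p.2 - U p.2)) * ψ p.1) (volume.prod ν) := by
  obtain ⟨C, hC⟩ := hψ.exists_bound
  exact integrable_mul_mul_of_bounded (hK.integrable_prod hA hf hg)
    (hψ.continuous.measurable.comp measurable_fst).aestronglyMeasurable fun p => hC _

lemma integrable_pairing [SFinite ν] (hK : IsTransferKernel ν κ U Z A) (hA : A ≠ ⊤)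
    (hf : HasSecondMoment f) (hg : HasSecondMoment g) {ψ : Vel d → ℝ} (hψ : IsTest ψ) :
    Integrable (fun θ => κ θ * ∫ x, f x * g (x - U θ) * ψ (x + Z θ)) ν := by
  have h := (hK.integrable_prod_mul hA hf hg hψ).integral_prod_right
  simpa only [integral_shift] using h

/-- The weak form of `transfer`: the displacement is transferred to the test function. -/
lemma integral_transfer_mul [SFinite ν] (hK : IsTransferKernel ν κ U Z A) (hA : A ≠ ⊤)
    (hf : HasSecondMoment f) (hg : HasSecondMoment g) {ψ : Vel d → ℝ} (hψ : IsTest ψ) :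
    ∫ v, transfer ν κ U Z f g v * ψ v =
      ∫ θ, κ θ * (∫ x, f x * g (x - U θ) * ψ (x + Z θ)) ∂ν := by
  simp_rw [← integral_shift]
  rw [← integral_integral_swap (hK.integrable_prod_mul hA hf hg hψ)]
  refine integral_congr_ae (Filter.Eventually.of_forall fun v => ?_)
  simp only [transfer]
  rw [← integral_mul_const]

lemma ae_rel (hK : IsTransferKernel ν κ U Z A) {p : Vel d → Prop} (hp : ∀ᵐ u, p u) :
    ∀ᵐ θ ∂ν, κ θ ≠ 0 → p (U θ) := by
  have hN : volume {u | ¬ p u} = 0 := hp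
  set N := toMeasurable volume {u | ¬ p u} with hNdef
  have hNm : MeasurableSet N := measurableSet_toMeasurable _ _
  have hN0 : volume N = 0 := by rw [hNdef, measure_toMeasurable, hN]
  have h := hK.lintegral_le (N.indicator 1) (measurable_one.indicator hNm)
  have hz : ∫⁻ u, eweight 2 u * N.indicator 1 u = 0 := by
    have : ∀ᵐ u, u ∉ N := measure_eq_zero_iff_ae_notMem.1 hN0
    refine (lintegral_congr_ae (g := fun _ => 0) ?_).trans lintegral_zero
    filter_upwards [this] with u hu
    simp [hu]
  have hm : Measurable fun θ => ‖κ θ‖ₑ * N.indicator (1 : Vel d → ℝ≥0∞) (U θ) :=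
    hK.measurable_rate.enorm.mul ((measurable_one.indicator hNm).comp hK.measurable_rel)
  rw [hz, mul_zero, nonpos_iff_eq_zero, lintegral_eq_zero_iff hm] at h
  filter_upwards [h] with θ hθ hne
  by_contra hc
  have hmem : U θ ∈ N := subset_toMeasurable _ _ hc
  simp [hmem, hne] at hθ

/-- The product rule integrated over all collisions. -/
lemma integral_rate_mul_coordDeriv [SFinite ν] (hK : IsTransferKernel ν κ U Z A) (hA : A ≠ ⊤)
    {i : Fin d} (hf : HasSecondMoment f) (hg : HasSecondMoment g) (hf' : HasSecondMoment f')
    (hg' : HasSecondMoment g') (hff : IsWeakPartial i f f') (hgg : IsWeakPartial i g g')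
    {ψ : Vel d → ℝ} (hψ : IsTest ψ) :
    ∫ θ, κ θ * (∫ x, f x * g (x - U θ) * coordDeriv i ψ (x + Z θ)) ∂ν =
      -((∫ v, transfer ν κ U Z f' g v * ψ v) + ∫ v, transfer ν κ U Z f g' v * ψ v) := by
  rw [hK.integral_transfer_mul hA hf' hg hψ, hK.integral_transfer_mul hA hf hg' hψ,
    ← integral_add (hK.integrable_pairing hA hf' hg hψ) (hK.integrable_pairing hA hf hg' hψ),
    ← integral_neg]
  refine integral_congr_ae ?_
  filter_upwards [hK.ae_rel (ae_leibniz hf.integrable hg.integrable hf'.integrable hg'.integrable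
    hff hgg hψ)] with θ hθ
  by_cases h0 : κ θ = 0
  · simp [h0]
  · rw [hθ h0 (Z θ)]; ring

/-- Translation invariance: `∂_i T(f, g) = T(∂_i f, g) + T(f, ∂_i g)`. -/
lemma isWeakPartial_transfer [SFinite ν] (hK : IsTransferKernel ν κ U Z A) (hA : A ≠ ⊤)
    {i : Fin d} (hf : HasSecondMoment f) (hg : HasSecondMoment g) (hf' : HasSecondMoment f')
    (hg' : HasSecondMoment g') (hff : IsWeakPartial i f f') (hgg : IsWeakPartial i g g') :
    IsWeakPartial i (transfer ν κ U Z f g)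
      (fun v => transfer ν κ U Z f' g v + transfer ν κ U Z f g' v) := by
  intro ψ hψ
  have hi : ∀ {h : Vel d → ℝ}, Integrable h → Integrable fun v => h v * ψ v := fun hh => by
    obtain ⟨C, hC⟩ := hψ.exists_bound
    exact integrable_mul_mul_of_bounded hh hψ.continuous.aestronglyMeasurable hC
  simp only [add_mul]
  rw [integral_add (hi (hK.integrable_transfer hA hf' hg)) (hi (hK.integrable_transfer hA hf hg')),
    ← hK.integral_rate_mul_coordDeriv hA hf hg hf' hg' hff hgg hψ,
    hK.integral_transfer_mul hA hf hg (hψ.isTest_coordDeriv i)]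

end IsTransferKernel

end TransferWeak

/-! ### Collision kernels -/

section Kernel

variable {d : ℕ} {b : ℝ → ℝ}

instance : IsFiniteMeasure (surface d) := by unfold surface; infer_instance

/-- The vector `|u| σ - u`. Collisions displace the velocity `v` along it. -/
def axis (p : Vel d × Sph d) : Vel d := ‖p.1‖ • (p.2 : Vel d) - p.1

/-- The collision rate `|u| b(σ · u/|u|)`. -/
def rate (b : ℝ → ℝ) (p : Vel d × Sph d) : ℝ := ‖p.1‖ * b ⟪(p.2 : Vel d), unitVec p.1⟫

/-- The product measure `du dσ`. -/
def paramMeasure (d : ℕ) : Measure (Vel d × Sph d) := (volume : Measure (Vel d)).prod (surface d)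

instance : SFinite (paramMeasure d) := by unfold paramMeasure; infer_instance

lemma measurable_unitVec : Measurable (unitVec : Vel d → Vel d) := by
  unfold unitVec; fun_prop

lemma continuous_axis : Continuous (axis : Vel d × Sph d → Vel d) := by
  unfold axis; fun_prop

lemma norm_axis_le (p : Vel d × Sph d) : ‖axis p‖ ≤ 2 * ‖p.1‖ := by
  have h1 : ‖(p.2 : Vel d)‖ = 1 := by simp
  calc ‖axis p‖ ≤ ‖‖p.1‖ • (p.2 : Vel d)‖ + ‖p.1‖ := norm_sub_le _ _
    _ = 2 * ‖p.1‖ := by rw [norm_smul, h1, norm_norm]; ring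

lemma norm_unitVec {u : Vel d} (hu : u ≠ 0) : ‖unitVec u‖ = 1 := by
  rw [unitVec, norm_smul, norm_inv, norm_norm, inv_mul_cancel₀ (norm_ne_zero_iff.2 hu)]

lemma IsAngularKernel.measurable_rate (hb : IsAngularKernel d b) :
    Measurable (rate b (d := d)) := by
  have := hb.measurable
  have := measurable_unitVec (d := d)
  unfold rate
  fun_prop

lemma IsAngularKernel.measurable_angle (hb : IsAngularKernel d b) (e : Vel d) :
    Measurable fun σ : Sph d => b ⟪(σ : Vel d), e⟫ := by
  have := hb.measurable
  fun_prop

lemma IsAngularKernel.nonneg_angle (hb : IsAngularKernel d b) {e : Vel d} (he : ‖e‖ = 1)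
    (σ : Sph d) : 0 ≤ b ⟪(σ : Vel d), e⟫ := by
  have h1 : ‖(σ : Vel d)‖ = 1 := by simp
  have := abs_real_inner_le_norm (σ : Vel d) e
  rw [h1, he, one_mul] at this
  exact hb.nonneg _ (abs_le.1 this)

lemma IsAngularKernel.integrable_angle (hb : IsAngularKernel d b) {e : Vel d} (he : ‖e‖ = 1) :
    Integrable (fun σ : Sph d => b ⟪(σ : Vel d), e⟫) (surface d) := by
  have h := hb.normalised ⟨e, by simpa using he⟩
  by_contra hc
  rw [integral_undef hc] at h
  norm_num at h

lemma IsAngularKernel.integral_angle (hb : IsAngularKernel d b) {e : Vel d} (he : ‖e‖ = 1) :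
    ∫ σ : Sph d, b ⟪(σ : Vel d), e⟫ ∂(surface d) = 1 :=
  hb.normalised ⟨e, by simpa using he⟩

lemma IsAngularKernel.lintegral_rate (hb : IsAngularKernel d b) (u : Vel d) :
    ∫⁻ σ, ‖rate b (u, σ)‖ₑ ∂(surface d) = ‖u‖ₑ := by
  by_cases hu : u = 0
  · simp [rate, hu]
  · have hu1 := norm_unitVec hu
    have h : ∫⁻ σ : Sph d, ‖b ⟪(σ : Vel d), unitVec u⟫‖ₑ ∂(surface d) = 1 := by
      rw [← ofReal_integral_norm_eq_lintegral_enorm (hb.integrable_angle hu1)]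
      simp_rw [Real.norm_of_nonneg (hb.nonneg_angle hu1 _)]
      rw [hb.integral_angle hu1, ENNReal.ofReal_one]
    simp only [rate, enorm_mul]
    rw [lintegral_const_mul _ (hb.measurable_angle _).enorm, h, mul_one, enorm_norm]

lemma IsAngularKernel.lintegral_rate_mul (hb : IsAngularKernel d b) {h : Vel d → ℝ≥0∞}
    (hh : Measurable h) :
    ∫⁻ p, ‖rate b p‖ₑ * h p.1 ∂(paramMeasure d) = ∫⁻ u, ‖u‖ₑ * h u := by
  have := hb.measurable_rate
  rw [paramMeasure, lintegral_prod _ (Measurable.aemeasurable (by fun_prop))]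
  refine lintegral_congr fun u => ?_
  simp only
  rw [lintegral_mul_const _ (by fun_prop), hb.lintegral_rate]

/-- The gain operator with displacement `β (|u| σ - u)` is of transfer type. -/
lemma IsAngularKernel.isTransferKernel (hb : IsAngularKernel d b) {β : ℝ} (h0 : 0 ≤ β)
    (h1 : β ≤ 1 / 2) :
    IsTransferKernel (paramMeasure d) (rate b) Prod.fst (fun p => β • axis p) 1 where
  measurable_rate := hb.measurable_rate
  measurable_rel := measurable_fst
  measurable_shift := (continuous_axis.const_smul β).measurable
  norm_shift_le := Filter.Eventually.of_forall fun p => by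
    rw [norm_smul, Real.norm_of_nonneg h0]
    nlinarith [norm_axis_le p, norm_nonneg (axis p)]
  lintegral_le h hh := by
    rw [hb.lintegral_rate_mul hh, one_mul]
    refine lintegral_mono fun u => ?_
    gcongr
    rw [eweight, weight_two, ← ofReal_norm]
    exact ENNReal.ofReal_le_ofReal (by nlinarith [sq_nonneg (‖u‖ - 1), norm_nonneg u])

/-- The operators arising in the derivative of the gain operator with respect to `β`; here the
parameter space contains `s ∈ (β, β']` as well. -/
lemma IsAngularKernel.isTransferKernel_axis (hb : IsAngularKernel d b) {β β' : ℝ} (h0 : 0 ≤ β)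
    (h1 : β' ≤ 1 / 2) (i : Fin d) :
    IsTransferKernel ((volume.restrict (Set.Ioc β β')).prod (paramMeasure d))
      (fun p : ℝ × Vel d × Sph d => rate b p.2 * axis p.2 i) (fun p => p.2.1)
      (fun p => p.1 • axis p.2) (2 * ENNReal.ofReal (β' - β)) where
  measurable_rate := by
    have := hb.measurable_rate
    have := continuous_axis (d := d).measurable
    fun_prop
  measurable_rel := by fun_prop
  measurable_shift := by
    have := continuous_axis (d := d).measurable
    fun_prop
  norm_shift_le := by
    have : ∀ᵐ s ∂(volume.restrict (Set.Ioc β β')), s ∈ Set.Ioc β β' :=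
      ae_restrict_mem measurableSet_Ioc
    filter_upwards [Measure.quasiMeasurePreserving_fst.ae this] with p hp
    rw [norm_smul, Real.norm_of_nonneg (h0.trans hp.1.le)]
    nlinarith [norm_axis_le p.2, norm_nonneg (axis p.2), hp.2]
  lintegral_le h hh := by
    have hr := hb.measurable_rate
    have ha := continuous_axis (d := d).measurable
    rw [lintegral_prod _ (Measurable.aemeasurable (by fun_prop))]
    simp only
    rw [lintegral_const, Measure.restrict_apply_univ, Real.volume_Ioc, mul_comm, mul_comm 2,
      mul_assoc]
    gcongr
    calc _ ≤ ∫⁻ p, ‖rate b p‖ₑ * (2 * ‖p.1‖ₑ * h p.1) ∂(paramMeasure d) := by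
          refine lintegral_mono fun p => ?_
          rw [enorm_mul, mul_assoc]
          gcongr
          rw [← ofReal_norm, ← ofReal_norm]
          refine (ENNReal.ofReal_le_ofReal
            ((PiLp.norm_apply_le _ i).trans (norm_axis_le p))).trans_eq ?_
          rw [ENNReal.ofReal_mul (by norm_num), ENNReal.ofReal_ofNat]
      _ = ∫⁻ u : Vel d, 2 * (‖u‖ₑ * ‖u‖ₑ * h u) := by
          rw [hb.lintegral_rate_mul (h := fun u => 2 * ‖u‖ₑ * h u) (by fun_prop)]
          refine lintegral_congr fun u => ?_
          ring
      _ = 2 * ∫⁻ u : Vel d, ‖u‖ₑ * ‖u‖ₑ * h u := lintegral_const_mul _ (by fun_prop)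
      _ ≤ _ := by
          gcongr with u
          rw [eweight, weight_two, ← ofReal_norm, ← ENNReal.ofReal_mul (norm_nonneg _)]
          exact ENNReal.ofReal_le_ofReal (by nlinarith)

end Kernel

/-! ### Dependence of the gain operator on the restitution coefficient -/

section Difference

variable {d : ℕ} {b : ℝ → ℝ}

/-- The gain operator `v ↦ ∫∫ |u| b(σ·û) f(v - βw) g(v - βw - u) dσ du` with `w = |u| σ - u`. -/
def gain (b : ℝ → ℝ) (β : ℝ) (f g : Vel d → ℝ) : Vel d → ℝ :=
  transfer (paramMeasure d) (rate b) Prod.fst (fun p => β • axis p) f g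

/-- One component of the `β`-derivative of the gain operator, integrated over `(β, β']`. -/
def gainIncrement (b : ℝ → ℝ) (β β' : ℝ) (i : Fin d) (f g : Vel d → ℝ) : Vel d → ℝ :=
  transfer ((volume.restrict (Set.Ioc β β')).prod (paramMeasure d))
      (fun p : ℝ × Vel d × Sph d => rate b p.2 * axis p.2 i) (fun p => p.2.1)
      (fun p => p.1 • axis p.2) f g

lemma fderiv_apply_eq_sum (ψ : Vel d → ℝ) (x w : Vel d) :
    fderiv ℝ ψ x w = ∑ i, w i * coordDeriv i ψ x := by
  conv_lhs => rw [← (EuclideanSpace.basisFun (Fin d) ℝ).sum_repr w]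
  simp [coordDeriv]

lemma IsTest.sub_eq_integral {ψ : Vel d → ℝ} (hψ : IsTest ψ) {β β' : ℝ} (h : β ≤ β')
    (x w : Vel d) :
    ψ (x + β' • w) - ψ (x + β • w) =
      ∫ s in Set.Ioc β β', ∑ i, w i * coordDeriv i ψ (x + s • w) := by
  rw [← intervalIntegral.integral_of_le h]
  have hc : ∀ i, Continuous (coordDeriv i ψ) := fun i => (hψ.isTest_coordDeriv i).continuous
  symm
  refine intervalIntegral.integral_eq_sub_of_hasDerivAt (f := fun s => ψ (x + s • w))
    (fun s _ => ?_) (Continuous.intervalIntegrable (by fun_prop) _ _)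
  rw [← fderiv_apply_eq_sum]
  have h1 : HasDerivAt (fun s : ℝ => x + s • w) w s := by
    simpa using ((hasDerivAt_id s).smul_const w).const_add x
  exact (hψ.differentiable _).hasFDerivAt.comp_hasDerivAt s h1

lemma integral_mul_sub_eq_sum {F ψ : Vel d → ℝ} (hF : Integrable F) (hψ : IsTest ψ) {β β' : ℝ}
    (h : β ≤ β') (w : Vel d) :
    ∫ x, F x * (ψ (x + β' • w) - ψ (x + β • w)) =
      ∑ i, ∫ s in Set.Ioc β β', w i * ∫ x, F x * coordDeriv i ψ (x + s • w) := by
  have hint : ∀ i, Integrable (Function.uncurry fun (x : Vel d) (s : ℝ) =>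
      F x * (w i * coordDeriv i ψ (x + s • w))) (volume.prod (volume.restrict (Set.Ioc β β'))) := by
    intro i
    obtain ⟨C, hC⟩ := (hψ.isTest_coordDeriv i).exists_bound
    have hc := (hψ.isTest_coordDeriv i).continuous
    have h1 : Integrable (fun p : Vel d × ℝ => F p.1 * 1)
      (volume.prod (volume.restrict (Set.Ioc β β'))) := hF.mul_prod (integrable_const (1 : ℝ))
    simp only [mul_one] at h1
    refine integrable_mul_mul_of_bounded (C := |w i| * C) h1
      (Continuous.aestronglyMeasurable (by fun_prop)) fun p => ?_
    rw [abs_mul]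
    exact mul_le_mul_of_nonneg_left (hC _) (abs_nonneg _)
  have hint' : ∀ i, Integrable (fun x : Vel d => ∫ s in Set.Ioc β β',
      F x * (w i * coordDeriv i ψ (x + s • w))) := fun i => (hint i).integral_prod_left
  have hs : ∀ i (x : Vel d), Integrable (fun s => w i * coordDeriv i ψ (x + s • w))
      (volume.restrict (Set.Ioc β β')) := fun i x => by
    have hc := (hψ.isTest_coordDeriv i).continuous
    exact (Continuous.integrableOn_Icc (by fun_prop)).mono_set Set.Ioc_subset_Icc_self
  calc _ = ∫ x, ∑ i, ∫ s in Set.Ioc β β', F x * (w i * coordDeriv i ψ (x + s • w)) := by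
        refine integral_congr_ae (Filter.Eventually.of_forall fun x => ?_)
        simp only
        rw [hψ.sub_eq_integral h, integral_finsetSum _ fun i _ => hs i x, Finset.mul_sum]
        simp_rw [integral_const_mul]
    _ = ∑ i, ∫ x, ∫ s in Set.Ioc β β', F x * (w i * coordDeriv i ψ (x + s • w)) :=
        integral_finsetSum _ fun i _ => hint' i
    _ = _ := by
        refine Finset.sum_congr rfl fun i _ => ?_
        rw [integral_integral_swap (hint i)]
        refine integral_congr_ae (Filter.Eventually.of_forall fun s => ?_)
        simp only
        rw [← integral_const_mul]
        refine integral_congr_ae (Filter.Eventually.of_forall fun x => ?_)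
        simp only; ring

lemma integrable_mul_test {h ψ : Vel d → ℝ} (hh : Integrable h) (hψ : IsTest ψ) :
    Integrable fun v => h v * ψ v := by
  obtain ⟨C, hC⟩ := hψ.exists_bound
  exact integrable_mul_mul_of_bounded hh hψ.continuous.aestronglyMeasurable hC

lemma ae_eq_of_integral_test_eq {h h' : Vel d → ℝ} (hh : LocallyIntegrable h)
    (hh' : LocallyIntegrable h') (H : ∀ ψ, IsTest ψ → ∫ v, h v * ψ v = ∫ v, h' v * ψ v) :
    h =ᵐ[volume] h' := by
  refine ae_eq_of_integral_contDiff_smul_eq hh hh' fun ψ h1 h2 => ?_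
  simpa only [smul_eq_mul, mul_comm] using H ψ ⟨h1, h2⟩

/-- The mean value formula in `β`. Against a test function, the `s`-derivative of
`ψ(x + s w)` is a combination of partial derivatives of `ψ`, which the product rule moves onto
`f` and `g`. -/
lemma gain_sub_gain_ae_eq (hb : IsAngularKernel d b) {β β' : ℝ} (h0 : 0 ≤ β) (hβ : β ≤ β')
    (h1 : β' ≤ 1 / 2) {f g : Vel d → ℝ} {f' g' : Fin d → Vel d → ℝ}
    (hf : HasSecondMoment f) (hg : HasSecondMoment g) (hf' : ∀ i, HasSecondMoment (f' i))
    (hg' : ∀ i, HasSecondMoment (g' i)) (hff : ∀ i, IsWeakPartial i f (f' i))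
    (hgg : ∀ i, IsWeakPartial i g (g' i)) :
    (fun v => gain b β' f g v - gain b β f g v) =ᵐ[volume]
      fun v => -∑ i, (gainIncrement b β β' i (f' i) g v + gainIncrement b β β' i f (g' i) v) := by
  have hK := hb.isTransferKernel h0 (hβ.trans h1)
  have hK' := hb.isTransferKernel (h0.trans hβ) h1
  have hKi := hb.isTransferKernel_axis h0 h1
  have hA : 2 * ENNReal.ofReal (β' - β) ≠ ⊤ := ENNReal.mul_ne_top (by simp) (by simp)
  have n1 : Integrable (gain b β f g) := hK.integrable_transfer (by simp) hf hg
  have n2 : Integrable (gain b β' f g) := hK'.integrable_transfer (by simp) hf hg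
  have n3 : ∀ i, Integrable (gainIncrement b β β' i (f' i) g) := fun i =>
    (hKi i).integrable_transfer hA (hf' i) hg
  have n4 : ∀ i, Integrable (gainIncrement b β β' i f (g' i)) := fun i =>
    (hKi i).integrable_transfer hA hf (hg' i)
  refine ae_eq_of_integral_test_eq (n2.sub n1).locallyIntegrable
    (integrable_finsetSum _ fun i _ => (n3 i).add (n4 i)).neg.locallyIntegrable fun ψ hψ => ?_
  have e1 : ∫ v, (gain b β' f g v - gain b β f g v) * ψ v =
      ∫ p, (∑ i, ∫ s in Set.Ioc β β', rate b p * axis p i *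
        ∫ x, f x * g (x - p.1) * coordDeriv i ψ (x + s • axis p)) ∂(paramMeasure d) := by
    simp only [sub_mul]
    rw [integral_sub (integrable_mul_test n2 hψ) (integrable_mul_test n1 hψ), gain, gain,
      hK'.integral_transfer_mul (by simp) hf hg hψ, hK.integral_transfer_mul (by simp) hf hg hψ,
      ← integral_sub (hK'.integrable_pairing (by simp) hf hg hψ)
        (hK.integrable_pairing (by simp) hf hg hψ)]
    refine integral_congr_ae ?_
    filter_upwards [hK.ae_rel (integrable_mul_sub hf.integrable hg.integrable).prod_right_ae]
      with p hp
    by_cases hr : rate b p = 0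
    · simp [hr]
    have hF : Integrable fun x => f x * g (x - p.1) := hp hr
    have h := integral_mul_sub_eq_sum hF hψ hβ (axis p)
    simp only [mul_sub] at h
    rw [integral_sub (integrable_mul_test hF (hψ.comp_add_right _))
      (integrable_mul_test hF (hψ.comp_add_right _))] at h
    rw [← mul_sub, h, Finset.mul_sum]
    refine Finset.sum_congr rfl fun i _ => ?_
    rw [← integral_const_mul]
    simp only [mul_assoc]
  have hint : ∀ i, Integrable (fun p : ℝ × Vel d × Sph d => rate b p.2 * axis p.2 i *
        ∫ x, f x * g (x - p.2.1) * coordDeriv i ψ (x + p.1 • axis p.2))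
        ((volume.restrict (Set.Ioc β β')).prod (paramMeasure d)) := fun i =>
    (hKi i).integrable_pairing hA hf hg (hψ.isTest_coordDeriv i)
  rw [e1, integral_finsetSum _ fun i _ => (hint i).integral_prod_right]
  simp only [neg_mul, Finset.sum_mul, add_mul]
  have n34 : ∀ i, Integrable fun v => gainIncrement b β β' i (f' i) g v * ψ v +
      gainIncrement b β β' i f (g' i) v * ψ v := fun i =>
    (integrable_mul_test (n3 i) hψ).add (integrable_mul_test (n4 i) hψ)
  rw [integral_neg, integral_finsetSum _ fun i _ => n34 i, ← Finset.sum_neg_distrib]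
  refine Finset.sum_congr rfl fun i _ => ?_
  rw [integral_add (integrable_mul_test (n3 i) hψ) (integrable_mul_test (n4 i) hψ)]
  refine (integral_prod_symm _ (hint i)).symm.trans ?_
  exact (hKi i).integral_rate_mul_coordDeriv hA hf hg (hf' i) (hg' i) (hff i) (hgg i) hψ

/-! ### Zeroth order estimate -/

/-- The transfer operators are bounded from `L^p(m_s) × L^p(m_s)` to `L^p(m_q)`, with norm at most
`C` times the constant of the kernel, and `L^p(m_s)` functions have finite second moments. -/
structure HasTransferBound (d : ℕ) (p : ℝ≥0∞) (q s : ℝ) (C : ℝ≥0∞) : Prop where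
  eLpNorm_le : ∀ {Ω : Type} [MeasurableSpace Ω] {ν : Measure Ω} [SFinite ν] {κ : Ω → ℝ}
    {U Z : Ω → Vel d} {A : ℝ≥0∞}, IsTransferKernel ν κ U Z A → ∀ {f g : Vel d → ℝ},
    Measurable f → Measurable g →
    eLpNorm (fun v => transfer ν κ U Z f g v * weight q v) p volume ≤
      A * C * (eLpNorm (fun v => f v * weight s v) p volume *
          eLpNorm (fun v => g v * weight s v) p volume)
  hasSecondMoment : ∀ {f : Vel d → ℝ}, Measurable f →
    eLpNorm (fun v => f v * weight s v) p volume < ⊤ → HasSecondMoment f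

lemma hasTransferBound_one {q : ℝ} (hq : 0 ≤ q) :
    HasTransferBound d 1 q (q + 2) (ENNReal.ofReal (8 ^ (q / 2) * 2)) where
  eLpNorm_le hK _ _ hf hg := hK.eLpNorm_one_transfer_le hq hf hg
  hasSecondMoment {f} hf h := by
    simp only [eLpNorm_one_eq_lintegral_enorm, enorm_mul, enorm_weight] at h
    refine ⟨hf, lt_of_le_of_lt (lintegral_mono fun v => ?_) h⟩
    gcongr
    exact eweight_mono (by linarith) v

lemma hasTransferBound_two {q r : ℝ} (hq : 0 ≤ q) (hr : (d : ℝ) / 2 < r) :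
    HasTransferBound d 2 q (q + r + 2) (((∫⁻ u : Vel d, eweight (-(2 * r)) u) *
          ENNReal.ofReal (8 ^ q * 2 ^ (r + 2))) ^ (1 / 2 : ℝ)) where
  eLpNorm_le hK _ _ hf hg := hK.eLpNorm_two_transfer_le hq
    (le_trans (by positivity) hr.le) hf hg
  hasSecondMoment {f} hf h := by
    have h2 := lintegral_rpow_enorm_lt_top_of_eLpNorm_lt_top (by norm_num) (by norm_num) h
    simp only [ENNReal.toReal_ofNat, ENNReal.rpow_two, enorm_mul, enorm_weight] at h2
    refine ⟨hf, ?_⟩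
    have h3 : (∫⁻ v, ‖f v‖ₑ * eweight 2 v) ^ 2 < ⊤ := by
      calc _ = (∫⁻ v, ‖f v‖ₑ * eweight (q + r + 2) v * eweight (-(q + r)) v) ^ 2 := by
            congr 1
            refine lintegral_congr fun v => ?_
            rw [mul_assoc, ← eweight_add]; congr 2; ring
        _ ≤ _ := lintegral_mul_sq_le _ (by fun_prop) (by fun_prop)
        _ < ⊤ := by
            refine ENNReal.mul_lt_top h2 ?_
            simp_rw [eweight_sq, mul_neg]
            exact lintegral_eweight_lt_top (by linarith)
    simpa using h3

/-- The estimate for `k = 0`. -/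
lemma eLpNorm_gain_sub_gain_le (hb : IsAngularKernel d b) {p C : ℝ≥0∞} {q s : ℝ}
    (hp : 1 ≤ p) (hT : HasTransferBound d p q s C) {β β' : ℝ} (h0 : 0 ≤ β) (hβ : β ≤ β')
    (h1 : β' ≤ 1 / 2) {f g : Vel d → ℝ} {f' g' : Fin d → Vel d → ℝ}
    (hf : HasSecondMoment f) (hg : HasSecondMoment g) (hf' : ∀ i, HasSecondMoment (f' i))
    (hg' : ∀ i, HasSecondMoment (g' i)) (hff : ∀ i, IsWeakPartial i f (f' i))
    (hgg : ∀ i, IsWeakPartial i g (g' i)) :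
    eLpNorm (fun v => (gain b β' f g v - gain b β f g v) * weight q v) p volume ≤
      2 * ENNReal.ofReal (β' - β) * C * ∑ i,
        (eLpNorm (fun v => f' i v * weight s v) p volume *
            eLpNorm (fun v => g v * weight s v) p volume +
          eLpNorm (fun v => f v * weight s v) p volume *
            eLpNorm (fun v => g' i v * weight s v) p volume) := by
  have hKi := hb.isTransferKernel_axis h0 h1
  have hw := (continuous_weight (d := d) q).measurable
  have m1 : ∀ i, Measurable (gainIncrement b β β' i (f' i) g) := fun i =>
    (hKi i).measurable_transfer (hf' i).measurable hg.measurable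
  have m2 : ∀ i, Measurable (gainIncrement b β β' i f (g' i)) := fun i =>
    (hKi i).measurable_transfer hf.measurable (hg' i).measurable
  have e : (fun v => (gain b β' f g v - gain b β f g v) * weight q v) =ᵐ[volume]
      -∑ i, ((fun v => gainIncrement b β β' i (f' i) g v * weight q v) +
        fun v => gainIncrement b β β' i f (g' i) v * weight q v) := by
    filter_upwards [gain_sub_gain_ae_eq hb h0 hβ h1 hf hg hf' hg' hff hgg] with v hv
    simp only [hv, Pi.neg_apply, Finset.sum_apply, Pi.add_apply, neg_mul, Finset.sum_mul, add_mul]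
  rw [eLpNorm_congr_ae e, eLpNorm_neg]
  refine (eLpNorm_sum_le (fun i _ => ((m1 i).mul hw).aestronglyMeasurable.add
    ((m2 i).mul hw).aestronglyMeasurable) hp).trans ?_
  rw [Finset.mul_sum]
  refine Finset.sum_le_sum fun i _ => ?_
  refine (eLpNorm_add_le ((m1 i).mul hw).aestronglyMeasurable
    ((m2 i).mul hw).aestronglyMeasurable hp).trans ?_
  rw [mul_add]
  exact add_le_add (hT.eLpNorm_le (hKi i) (hf' i).measurable hg.measurable)
    (hT.eLpNorm_le (hKi i) hf.measurable (hg' i).measurable)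

end Difference

/-! ### Existence and uniqueness of the collision operator -/

section Collision

variable {d : ℕ} {b : ℝ → ℝ} {f g : Vel d → ℝ}

lemma measurePreserving_neg_surface :
    MeasurePreserving (fun σ : Sph d => -σ) (surface d) (surface d) := by
  have hm : Measurable fun σ : Sph d => -σ := continuous_neg.measurable
  refine ⟨hm, Measure.ext fun s hs => ?_⟩
  rw [Measure.map_apply hm hs, surface, Measure.toSphere_apply' _ (hm hs),
    Measure.toSphere_apply' _ hs]
  congr 1
  rw [← Measure.measure_neg volume]
  congr 1
  ext x
  simp only [Set.mem_neg, Set.mem_smul, Set.mem_image, Set.mem_preimage]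
  constructor
  · rintro ⟨r, hr, _, ⟨σ, hσ, rfl⟩, h⟩
    exact ⟨r, hr, _, ⟨-σ, hσ, rfl⟩, by simp [h]⟩
  · rintro ⟨r, hr, _, ⟨σ, hσ, rfl⟩, h⟩
    exact ⟨r, hr, _, ⟨-σ, by simpa using hσ, rfl⟩, by simp [h]⟩

/-- The angular average of `ψ(v')` when the displacement is `β (|u| σ - u)`. -/
def postAverage (b : ℝ → ℝ) (β : ℝ) (ψ : Vel d → ℝ) (v vs : Vel d) : ℝ :=
  ∫ σ : Sph d, ψ (v + β • axis (v - vs, σ)) * b ⟪(σ : Vel d), unitVec (v - vs)⟫ ∂(surface d)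

/-- The integrand of the weak form of the gain operator. -/
def gainIntegrand (b : ℝ → ℝ) (β : ℝ) (ψ f g : Vel d → ℝ) (p : Vel d × Vel d) : ℝ :=
  f p.1 * g p.2 * ‖p.1 - p.2‖ * postAverage b β ψ p.1 p.2

lemma unitVec_neg (u : Vel d) : unitVec (-u) = -unitVec u := by
  simp [unitVec]

lemma axis_neg (u : Vel d) (σ : Sph d) : axis (-u, σ) = -axis (u, -σ) := by
  simp [axis]; abel

/-- Exchanging the two particles amounts to `u ↦ -u`, `σ ↦ -σ`. -/
lemma integral_postStar (b : ℝ → ℝ) (β : ℝ) (ψ : Vel d → ℝ) (v vs : Vel d) :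
    ∫ σ : Sph d, ψ (vs - β • axis (v - vs, σ)) * b ⟪(σ : Vel d), unitVec (v - vs)⟫ ∂(surface d) =
      postAverage b β ψ vs v := by
  rw [postAverage, ← (measurePreserving_neg_surface (d := d)).integral_comp
    (Homeomorph.neg (Sph d)).measurableEmbedding]
  refine integral_congr_ae (Filter.Eventually.of_forall fun σ => ?_)
  simp only
  rw [← neg_sub v vs, axis_neg, unitVec_neg, smul_neg, ← sub_eq_add_neg]
  simp

lemma IsAngularKernel.integrable_test_mul (hb : IsAngularKernel d b) {ψ : Vel d → ℝ}
    (hψ : IsTest ψ) {e : Vel d} (he : ‖e‖ = 1) {ζ : Sph d → Vel d} (hζ : Continuous ζ) :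
    Integrable (fun σ : Sph d => ψ (ζ σ) * b ⟪(σ : Vel d), e⟫) (surface d) := by
  obtain ⟨C, hC⟩ := hψ.exists_bound
  have := hψ.continuous
  exact (hb.integrable_angle he).bdd_mul (Continuous.aestronglyMeasurable (by fun_prop))
    (Filter.Eventually.of_forall fun σ => hC _)

lemma HasSecondMoment.integrable_mul (hf : HasSecondMoment f) :
    Integrable fun v => f v * (1 + ‖v‖ ^ 2) := by
  have hm := hf.measurable
  refine ⟨Measurable.aestronglyMeasurable (by fun_prop), ?_⟩
  unfold HasFiniteIntegral
  simp_rw [← weight_two, enorm_mul, enorm_weight]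
  exact hf.lintegral_lt_top

lemma IsAngularKernel.abs_norm_mul_postAverage_le (hb : IsAngularKernel d b) {ψ : Vel d → ℝ} {C : ℝ}
    (hC : ∀ v, |ψ v| ≤ C) (β : ℝ) (v vs : Vel d) :
    |‖v - vs‖ * postAverage b β ψ v vs| ≤ C * ((1 + ‖v‖ ^ 2) * (1 + ‖vs‖ ^ 2)) := by
  have hC0 : 0 ≤ C := (abs_nonneg _).trans (hC 0)
  rw [abs_mul, abs_norm, mul_comm]
  by_cases hu : v - vs = 0
  · rw [hu]; simp; positivity
  refine mul_le_mul ?_ ?_ (norm_nonneg _) hC0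
  · have hu1 := norm_unitVec hu
    calc |postAverage b β ψ v vs| ≤ ∫ σ : Sph d, |ψ (v + β • axis (v - vs, σ)) *
          b ⟪(σ : Vel d), unitVec (v - vs)⟫| ∂(surface d) := abs_integral_le_integral_abs
      _ ≤ ∫ σ : Sph d, C * b ⟪(σ : Vel d), unitVec (v - vs)⟫ ∂(surface d) := by
          refine integral_mono_of_nonneg (Filter.Eventually.of_forall fun σ => abs_nonneg _)
            ((hb.integrable_angle hu1).const_mul C) (Filter.Eventually.of_forall fun σ => ?_)
          simp only
          rw [abs_mul, abs_of_nonneg (hb.nonneg_angle hu1 σ)]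
          exact mul_le_mul_of_nonneg_right (hC _) (hb.nonneg_angle hu1 σ)
      _ = C := by rw [integral_const_mul, hb.integral_angle hu1, mul_one]
  · nlinarith [norm_sub_le v vs, sq_nonneg (‖v‖ - 1), sq_nonneg (‖vs‖ - 1), norm_nonneg v,
      norm_nonneg vs, mul_nonneg (sq_nonneg ‖v‖) (sq_nonneg ‖vs‖)]

lemma IsAngularKernel.integrable_gainIntegrand (hb : IsAngularKernel d b) (β : ℝ)
    (hf : HasSecondMoment f) (hg : HasSecondMoment g) {ψ : Vel d → ℝ} (hψ : IsTest ψ) :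
    Integrable (gainIntegrand b β ψ f g) (volume.prod volume) := by
  obtain ⟨C, hC⟩ := hψ.exists_bound
  have hfm := hf.measurable
  have hgm := hg.measurable
  have hbm := hb.measurable
  have hu := measurable_unitVec (d := d)
  have ha := continuous_axis (d := d).measurable
  have hψm := hψ.continuous.measurable
  have hP : Measurable fun p : Vel d × Vel d => postAverage b β ψ p.1 p.2 := by
    have : StronglyMeasurable (fun q : (Vel d × Vel d) × Sph d =>
        ψ (q.1.1 + β • axis (q.1.1 - q.1.2, q.2)) *
          b ⟪(q.2 : Vel d), unitVec (q.1.1 - q.1.2)⟫) :=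
      Measurable.stronglyMeasurable (by fun_prop)
    exact this.integral_prod_right.measurable
  have hdom := (hf.integrable_mul.mul_prod hg.integrable_mul).const_mul C
  refine hdom.mono (Measurable.aestronglyMeasurable (by unfold gainIntegrand; fun_prop))
    (Filter.Eventually.of_forall fun p => ?_)
  have h := hb.abs_norm_mul_postAverage_le hC β p.1 p.2
  have hC0 : 0 ≤ C := (abs_nonneg _).trans (hC 0)
  calc ‖gainIntegrand b β ψ f g p‖
      = |f p.1 * g p.2| * |‖p.1 - p.2‖ * postAverage b β ψ p.1 p.2| := by
        rw [gainIntegrand, mul_assoc, Real.norm_eq_abs, abs_mul]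
    _ ≤ |f p.1 * g p.2| * (C * ((1 + ‖p.1‖ ^ 2) * (1 + ‖p.2‖ ^ 2))) := by gcongr
    _ = _ := by
        rw [Real.norm_eq_abs, abs_mul C, abs_of_nonneg hC0, abs_mul, abs_mul, abs_mul (f p.1),
          abs_mul (g p.2), abs_of_nonneg (one_add_norm_sq_pos p.1).le,
          abs_of_nonneg (one_add_norm_sq_pos p.2).le]
        ring

lemma IsAngularKernel.integral_gain_mul (hb : IsAngularKernel d b) {β : ℝ} (h0 : 0 ≤ β)
    (h1 : β ≤ 1 / 2) (hf : HasSecondMoment f) (hg : HasSecondMoment g) {ψ : Vel d → ℝ}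
    (hψ : IsTest ψ) :
    ∫ v, gain b β f g v * ψ v = ∫ v, ∫ vs, gainIntegrand b β ψ f g (v, vs) := by
  have hK := hb.isTransferKernel h0 h1
  obtain ⟨C, hC⟩ := hψ.exists_bound
  have hψm := hψ.continuous.measurable
  have ha := continuous_axis (d := d).measurable
  have H : Integrable (Function.uncurry fun (x : Vel d) (p : Vel d × Sph d) =>
      rate b p * (f x * g (x - p.1) * ψ (x + β • axis p))) (volume.prod (paramMeasure d)) := by
    have h2 := (hb.isTransferKernel le_rfl (by norm_num)).integrable_prod (by simp) hf hg
    refine (integrable_mul_mul_of_bounded h2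
      (χ := fun q : Vel d × Vel d × Sph d => ψ (q.1 + β • axis q.2))
      (Measurable.aestronglyMeasurable (by fun_prop)) fun q => hC _).congr
      (Filter.Eventually.of_forall fun q => ?_)
    simp only [Function.uncurry, zero_smul, sub_zero]; ring
  rw [gain, hK.integral_transfer_mul (by simp) hf hg hψ]
  simp_rw [← integral_const_mul]
  rw [← integral_integral_swap H]
  refine integral_congr_ae ?_
  filter_upwards [H.prod_right_ae] with x hx
  simp only [Function.uncurry, paramMeasure] at hx ⊢
  rw [integral_prod _ hx, ← integral_sub_left_eq_self (fun vs => gainIntegrand b β ψ f g (x, vs))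
    volume x]
  refine integral_congr_ae (Filter.Eventually.of_forall fun u => ?_)
  simp only [gainIntegrand, postAverage, sub_sub_cancel]
  rw [← integral_const_mul]
  refine integral_congr_ae (Filter.Eventually.of_forall fun σ => ?_)
  simp only [rate]; ring

/-- The collision operator with displacement `β (|u| σ - u)`. The loss term is the gain operator
without displacement, `β = 0`. -/
def collisionOp (F : Form) (b : ℝ → ℝ) (β : ℝ) (f g : Vel d → ℝ) (v : Vel d) : ℝ :=
  match F with
  | Form.symmetric => (1 / 2) * ((gain b β f g v - gain b 0 f g v) +
      (gain b β g f v - gain b 0 g f v))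
  | Form.gainLoss => gain b β f g v - gain b 0 f g v

lemma IsAngularKernel.integrable_gain (hb : IsAngularKernel d b) {β : ℝ} (h0 : 0 ≤ β)
    (h1 : β ≤ 1 / 2) (hf : HasSecondMoment f) (hg : HasSecondMoment g) :
    Integrable (gain b β f g) :=
  (hb.isTransferKernel h0 h1).integrable_transfer (by simp) hf hg

lemma IsAngularKernel.integrand_gainLoss (hb : IsAngularKernel d b) (α : ℝ) (f g : Vel d → ℝ)
    {ψ : Vel d → ℝ} (hψ : IsTest ψ) (v vs : Vel d) :
    f v * g vs * ‖v - vs‖ * angularAverage Form.gainLoss b α ψ v vs =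
      gainIntegrand b ((1 + α) / 4) ψ f g (v, vs) - gainIntegrand b 0 ψ f g (v, vs) := by
  by_cases hu : v - vs = 0
  · simp [gainIntegrand, hu]
  have hu1 := norm_unitVec hu
  have hc : ∀ γ : ℝ, Continuous fun σ : Sph d => v + γ • axis (v - vs, σ) := fun γ => by
    have := continuous_axis (d := d)
    fun_prop
  rw [gainIntegrand, gainIntegrand, ← mul_sub, postAverage, postAverage,
    ← integral_sub (hb.integrable_test_mul hψ hu1 (hc _)) (hb.integrable_test_mul hψ hu1 (hc _))]
  congr 1
  refine integral_congr_ae (Filter.Eventually.of_forall fun σ => ?_)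
  simp only [increment, post, jump, axis, zero_smul, add_zero]
  ring

lemma IsAngularKernel.integrand_symmetric (hb : IsAngularKernel d b) (α : ℝ) (f g : Vel d → ℝ)
    {ψ : Vel d → ℝ} (hψ : IsTest ψ) (v vs : Vel d) :
    f v * g vs * ‖v - vs‖ * angularAverage Form.symmetric b α ψ v vs =
      (1 / 2) * ((gainIntegrand b ((1 + α) / 4) ψ f g (v, vs) - gainIntegrand b 0 ψ f g (v, vs)) +
        (gainIntegrand b ((1 + α) / 4) ψ g f (vs, v) - gainIntegrand b 0 ψ g f (vs, v))) := by
  by_cases hu : v - vs = 0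
  · simp [gainIntegrand, sub_eq_zero.1 hu]
  have hu1 := norm_unitVec hu
  have hax := continuous_axis (d := d)
  have hc : ∀ γ : ℝ, Continuous fun σ : Sph d => v + γ • axis (v - vs, σ) := fun γ => by fun_prop
  have hc' : ∀ γ : ℝ, Continuous fun σ : Sph d => vs - γ • axis (v - vs, σ) := fun γ => by
    fun_prop
  have i1 := fun γ => hb.integrable_test_mul hψ hu1 (hc γ)
  have i2 := fun γ => hb.integrable_test_mul hψ hu1 (hc' γ)
  have s1 : Integrable (fun σ : Sph d =>
      ψ (v + ((1 + α) / 4) • axis (v - vs, σ)) * b ⟪(σ : Vel d), unitVec (v - vs)⟫ -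
        ψ (v + (0 : ℝ) • axis (v - vs, σ)) * b ⟪(σ : Vel d), unitVec (v - vs)⟫) (surface d) :=
    (i1 _).sub (i1 _)
  have s2 : Integrable (fun σ : Sph d =>
      ψ (vs - ((1 + α) / 4) • axis (v - vs, σ)) * b ⟪(σ : Vel d), unitVec (v - vs)⟫ -
        ψ (vs - (0 : ℝ) • axis (v - vs, σ)) * b ⟪(σ : Vel d), unitVec (v - vs)⟫) (surface d) :=
    (i2 _).sub (i2 _)
  have key : angularAverage Form.symmetric b α ψ v vs =
      (1 / 2) * ((postAverage b ((1 + α) / 4) ψ v vs - postAverage b 0 ψ v vs) +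
        (postAverage b ((1 + α) / 4) ψ vs v - postAverage b 0 ψ vs v)) := by
    rw [← integral_postStar b ((1 + α) / 4) ψ v vs, ← integral_postStar b 0 ψ v vs,
      postAverage, postAverage,
      ← integral_sub (i1 _) (i1 _), ← integral_sub (i2 _) (i2 _),
      ← integral_add s1 s2, ← integral_const_mul]
    refine integral_congr_ae (Filter.Eventually.of_forall fun σ => ?_)
    simp only [increment, post, postStar, jump, axis, zero_smul, add_zero, sub_zero]
    ring
  simp only [gainIntegrand]
  rw [key, norm_sub_rev vs v]
  ring

lemma IsAngularKernel.isCollision_collisionOp (hb : IsAngularKernel d b) (F : Form) {α : ℝ}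
    (h0 : 0 < α) (h1 : α ≤ 1) (hf : HasSecondMoment f) (hg : HasSecondMoment g) :
    IsCollision F b α g f (collisionOp F b ((1 + α) / 4) f g) := by
  have hβ0 : 0 ≤ (1 + α) / 4 := by linarith
  have hβ1 : (1 + α) / 4 ≤ 1 / 2 := by linarith
  have hz : (0 : ℝ) ≤ 1 / 2 := by norm_num
  have i1 : Integrable fun v => gain b ((1 + α) / 4) f g v - gain b 0 f g v :=
    (hb.integrable_gain hβ0 hβ1 hf hg).sub (hb.integrable_gain le_rfl hz hf hg)
  have i2 : Integrable fun v => gain b ((1 + α) / 4) g f v - gain b 0 g f v :=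
    (hb.integrable_gain hβ0 hβ1 hg hf).sub (hb.integrable_gain le_rfl hz hg hf)
  have weak : ∀ {f g : Vel d → ℝ}, HasSecondMoment f → HasSecondMoment g → ∀ {ψ : Vel d → ℝ},
      IsTest ψ → ∫ v, (gain b ((1 + α) / 4) f g v - gain b 0 f g v) * ψ v =
      ∫ p : Vel d × Vel d, gainIntegrand b ((1 + α) / 4) ψ f g p - gainIntegrand b 0 ψ f g p
        ∂(volume.prod volume) := by
    intro f g hf hg ψ hψ
    simp only [sub_mul]
    have j1 := hb.integrable_gainIntegrand ((1 + α) / 4) hf hg hψ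
    have j2 := hb.integrable_gainIntegrand 0 hf hg hψ
    rw [integral_sub (integrable_mul_test (hb.integrable_gain hβ0 hβ1 hf hg) hψ)
      (integrable_mul_test (hb.integrable_gain le_rfl hz hf hg) hψ), integral_sub j1 j2,
      hb.integral_gain_mul hβ0 hβ1 hf hg hψ, hb.integral_gain_mul le_rfl hz hf hg hψ,
      integral_prod _ j1, integral_prod _ j2]
  have hint : ∀ {f g : Vel d → ℝ}, HasSecondMoment f → HasSecondMoment g → ∀ {ψ : Vel d → ℝ},
      IsTest ψ → Integrable (fun p => gainIntegrand b ((1 + α) / 4) ψ f g p -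
        gainIntegrand b 0 ψ f g p) (volume.prod volume) := fun hf hg _ hψ =>
    (hb.integrable_gainIntegrand _ hf hg hψ).sub (hb.integrable_gainIntegrand _ hf hg hψ)
  cases F with
  | gainLoss =>
    refine ⟨i1.locallyIntegrable, fun ψ hψ => ?_⟩
    simp only [collisionOp, hb.integrand_gainLoss α f g hψ]
    rw [weak hf hg hψ, integral_prod _ (hint hf hg hψ)]
  | symmetric =>
    refine ⟨((i1.add i2).const_mul (1 / 2)).locallyIntegrable, fun ψ hψ => ?_⟩
    simp only [collisionOp, hb.integrand_symmetric α f g hψ]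
    have hsw : Integrable (fun p : Vel d × Vel d => gainIntegrand b ((1 + α) / 4) ψ g f p.swap -
        gainIntegrand b 0 ψ g f p.swap) (volume.prod volume) := (hint hg hf hψ).swap
    have hsum : Integrable (fun p : Vel d × Vel d => (1 / 2 : ℝ) *
        ((gainIntegrand b ((1 + α) / 4) ψ f g p - gainIntegrand b 0 ψ f g p) +
        (gainIntegrand b ((1 + α) / 4) ψ g f p.swap - gainIntegrand b 0 ψ g f p.swap)))
        (volume.prod volume) := ((hint hf hg hψ).add hsw).const_mul _
    refine Eq.trans ?_ (integral_prod _ hsum)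
    simp only [mul_assoc, add_mul]
    rw [integral_const_mul, integral_const_mul,
      integral_add (integrable_mul_test i1 hψ) (integrable_mul_test i2 hψ),
      integral_add (hint hf hg hψ) hsw, weak hf hg hψ, weak hg hf hψ]
    congr 2
    exact (integral_prod_swap (μ := volume) (ν := volume) (fun p : Vel d × Vel d =>
      gainIntegrand b ((1 + α) / 4) ψ g f p - gainIntegrand b 0 ψ g f p)).symm

lemma IsCollision.congr {F : Form} {α : ℝ} {f' g' Q : Vel d → ℝ} (h : IsCollision F b α g f Q)
    (hf : f =ᵐ[volume] f') (hg : g =ᵐ[volume] g') : IsCollision F b α g' f' Q := by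
  refine ⟨h.1, fun ψ hψ => (h.2 ψ hψ).trans (integral_congr_ae ?_)⟩
  filter_upwards [hf] with v hv
  refine integral_congr_ae ?_
  filter_upwards [hg] with vs hvs
  rw [hv, hvs]

lemma IsCollision.ae_eq {F : Form} {α : ℝ} {Q Q' : Vel d → ℝ} (h : IsCollision F b α g f Q)
    (h' : IsCollision F b α g f Q') : Q =ᵐ[volume] Q' :=
  ae_eq_of_integral_test_eq h.1 h'.1 fun ψ hψ => (h.2 ψ hψ).trans (h'.2 ψ hψ).symm

end Collision

/-! ### Families of weak derivatives -/

section Family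

variable {d : ℕ}

/-- A family of functions indexed by multi-indices, meant to hold the iterated weak derivatives of
its zeroth member. -/
abbrev DerivFamily (d : ℕ) : Type := (j : ℕ) → (Fin j → Fin d) → Vel d → ℝ

/-- The family of derivatives of the `i`-th partial derivative of the zeroth member. -/
def shift (D : DerivFamily d) (i : Fin d) : DerivFamily d := fun j J => D (j + 1) (Fin.cons i J)

lemma partialDeriv_cons {φ : Vel d → ℝ} (hφ : IsTest φ) {j : ℕ} (i : Fin d) (J : Fin j → Fin d) :
    partialDeriv (Fin.cons i J) φ = coordDeriv i (partialDeriv J φ) := by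
  ext v
  have hd : DifferentiableAt ℝ (iteratedFDeriv ℝ j φ) v :=
    (hφ.1.differentiable_iteratedFDeriv (by exact_mod_cast ENat.natCast_lt_top j)) v
  have hJ : partialDeriv J φ = fun y =>
      iteratedFDeriv ℝ j φ y fun l => EuclideanSpace.single (J l) (1 : ℝ) := rfl
  rw [coordDeriv, hJ, partialDeriv, iteratedFDeriv_succ_apply_left,
    fderiv_continuousMultilinear_apply_const_apply hd]
  rfl

lemma partialDeriv_zero (φ : Vel d → ℝ) (I : Fin 0 → Fin d) : partialDeriv I φ = φ := by
  ext v; simp [partialDeriv]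

lemma IsTest.isTest_partialDeriv {φ : Vel d → ℝ} (hφ : IsTest φ) :
    ∀ {j : ℕ} (I : Fin j → Fin d), IsTest (partialDeriv I φ)
  | 0, I => by rwa [partialDeriv_zero]
  | j + 1, I => by
    rw [← Fin.cons_self_tail I, partialDeriv_cons hφ]
    exact (hφ.isTest_partialDeriv _).isTest_coordDeriv _

/-- `D` holds, up to order `k`, iterated weak derivatives with finite second moments of its
zeroth member. -/
structure IsSobolevFamily (k : ℕ) (D : DerivFamily d) : Prop where
  hasSecondMoment : ∀ j ≤ k, ∀ I : Fin j → Fin d, HasSecondMoment (D j I)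
  integral_eq : ∀ j ≤ k, ∀ I : Fin j → Fin d, ∀ φ, IsTest φ →
    ∫ v, D 0 ![] v * partialDeriv I φ v = (-1) ^ j * ∫ v, D j I v * φ v

namespace IsSobolevFamily

variable {k : ℕ} {D : DerivFamily d}

lemma isWeakPartial (hD : IsSobolevFamily (k + 1) D) (i : Fin d) :
    IsWeakPartial i (D 0 ![]) (shift D i 0 ![]) := by
  intro φ hφ
  have := hD.integral_eq 1 (by omega) (Fin.cons i ![]) φ hφ
  rw [partialDeriv_cons hφ, partialDeriv_zero] at this
  simpa [shift] using this

lemma shift (hD : IsSobolevFamily (k + 1) D) (i : Fin d) : IsSobolevFamily k (shift D i) := by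
  refine ⟨fun j hj I => hD.hasSecondMoment (j + 1) (by omega) _, fun j hj I φ hφ => ?_⟩
  have h1 := hD.integral_eq (j + 1) (by omega) (Fin.cons i I) φ hφ
  rw [partialDeriv_cons hφ, hD.isWeakPartial i _ (hφ.isTest_partialDeriv I), pow_succ] at h1
  simp only [Granular.shift] at h1 ⊢
  linarith

lemma mono (hD : IsSobolevFamily k D) {m : ℕ} (h : m ≤ k) : IsSobolevFamily m D :=
  ⟨fun j hj => hD.hasSecondMoment j (hj.trans h), fun j hj => hD.integral_eq j (hj.trans h)⟩

end IsSobolevFamily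

/-- The iterated product rule for a bilinear operator `T` with
`∂_i T(f, g) = T(∂_i f, g) + T(f, ∂_i g)`: the derivative of `T (A 0 ![]) (B 0 ![])` along `I`. -/
def leibniz (T : (Vel d → ℝ) → (Vel d → ℝ) → Vel d → ℝ) :
    (n : ℕ) → DerivFamily d → DerivFamily d → (Fin n → Fin d) → Vel d → ℝ
  | 0, A, B, _ => T (A 0 ![]) (B 0 ![])
  | n + 1, A, B, I => fun v =>
    leibniz T n (shift A (I 0)) B (Fin.tail I) v + leibniz T n A (shift B (I 0)) (Fin.tail I) v

/-- A bilinear operator on functions with finite second moments that has integrable values and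
satisfies the product rule for weak derivatives. -/
structure IsLeibniz (T : (Vel d → ℝ) → (Vel d → ℝ) → Vel d → ℝ) : Prop where
  integrable : ∀ {f g}, HasSecondMoment f → HasSecondMoment g → Integrable (T f g)
  isWeakPartial : ∀ {i f g f' g'}, HasSecondMoment f → HasSecondMoment g → HasSecondMoment f' →
    HasSecondMoment g' → IsWeakPartial i f f' → IsWeakPartial i g g' →
    IsWeakPartial i (T f g) fun v => T f' g v + T f g' v

namespace IsLeibniz

variable {T : (Vel d → ℝ) → (Vel d → ℝ) → Vel d → ℝ}

lemma integrable_leibniz (hT : IsLeibniz T) {n : ℕ} : ∀ {A B : DerivFamily d},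
    IsSobolevFamily n A → IsSobolevFamily n B → ∀ I, Integrable (leibniz T n A B I) := by
  induction n with
  | zero =>
    intro A B hA hB I
    exact hT.integrable (hA.hasSecondMoment 0 le_rfl _) (hB.hasSecondMoment 0 le_rfl _)
  | succ n ih =>
    intro A B hA hB I
    exact (ih (hA.shift _) (hB.mono (by omega)) _).add (ih (hA.mono (by omega)) (hB.shift _) _)

lemma integral_partialDeriv (hT : IsLeibniz T) {n : ℕ} : ∀ {A B : DerivFamily d},
    IsSobolevFamily n A → IsSobolevFamily n B → ∀ (I : Fin n → Fin d) {φ : Vel d → ℝ},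
    IsTest φ → ∫ v, T (A 0 ![]) (B 0 ![]) v * partialDeriv I φ v =
      (-1) ^ n * ∫ v, leibniz T n A B I v * φ v := by
  induction n with
  | zero =>
    intro A B hA hB I φ hφ
    simp [partialDeriv_zero, leibniz]
  | succ n ih =>
    intro A B hA hB I φ hφ
    have hA0 := hA.hasSecondMoment 0 (by omega) ![]
    have hB0 := hB.hasSecondMoment 0 (by omega) ![]
    have hA1 := (hA.shift (I 0)).hasSecondMoment 0 (by omega) ![]
    have hB1 := (hB.shift (I 0)).hasSecondMoment 0 (by omega) ![]
    have hφ' := hφ.isTest_partialDeriv (Fin.tail I)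
    have hAn := hA.mono (Nat.le_succ n)
    have hBn := hB.mono (Nat.le_succ n)
    have hI : partialDeriv I φ = coordDeriv (I 0) (partialDeriv (Fin.tail I) φ) := by
      rw [← partialDeriv_cons hφ, Fin.cons_self_tail]
    simp only [leibniz, add_mul]
    rw [hI, hT.isWeakPartial hA0 hB0 hA1 hB1 (hA.isWeakPartial _) (hB.isWeakPartial _) _ hφ',
      integral_add (integrable_mul_test (hT.integrable_leibniz (hA.shift _) hBn _) hφ)
        (integrable_mul_test (hT.integrable_leibniz hAn (hB.shift _) _) hφ)]
    simp only [add_mul]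
    rw [integral_add (integrable_mul_test (hT.integrable hA1 hB0) hφ')
      (integrable_mul_test (hT.integrable hA0 hB1) hφ'), ih (hA.shift _) hBn _ hφ,
      ih hAn (hB.shift _) _ hφ, pow_succ]
    ring

end IsLeibniz

/-! ### Norms of families -/

/-- The Sobolev norm computed from a family of derivatives. -/
def familyNorm (m : ℕ) (p : ℝ≥0∞) (s : ℝ) (D : DerivFamily d) : ℝ≥0∞ :=
  ∑ j ∈ Finset.range (m + 1), eLpNorm (fun v => tensorLength (D j) v * weight s v) p volume

lemma tensorLength_nonneg {j : ℕ} (D : (Fin j → Fin d) → Vel d → ℝ) (v : Vel d) :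
    0 ≤ tensorLength D v := Real.sqrt_nonneg _

lemma abs_le_tensorLength {j : ℕ} (D : (Fin j → Fin d) → Vel d → ℝ) (I : Fin j → Fin d)
    (v : Vel d) : |D I v| ≤ tensorLength D v := by
  rw [← Real.sqrt_sq_eq_abs]
  exact Real.sqrt_le_sqrt (Finset.single_le_sum (f := fun I => D I v ^ 2)
    (fun I _ => sq_nonneg _) (Finset.mem_univ I))

lemma tensorLength_le_sum {j : ℕ} (D : (Fin j → Fin d) → Vel d → ℝ) (v : Vel d) :
    tensorLength D v ≤ ∑ I, |D I v| := by
  rw [tensorLength, Real.sqrt_le_left (Finset.sum_nonneg fun I _ => abs_nonneg _)]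
  simp_rw [← sq_abs (D _ v)]
  exact Finset.sum_sq_le_sq_sum_of_nonneg fun I _ => abs_nonneg _

lemma tensorLength_shift_le (D : DerivFamily d) (i : Fin d) (j : ℕ) (v : Vel d) :
    tensorLength (shift D i j) v ≤ tensorLength (D (j + 1)) v := by
  refine Real.sqrt_le_sqrt ?_
  have hinj : Function.Injective fun J : Fin j → Fin d => (Fin.cons i J : Fin (j + 1) → Fin d) :=
    fun J J' h => by simpa only [Fin.tail_cons] using congrArg Fin.tail h
  exact (Finset.sum_image (f := fun I => D (j + 1) I v ^ 2) (s := Finset.univ)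
    (g := fun J : Fin j → Fin d => (Fin.cons i J : Fin (j + 1) → Fin d))
    (fun _ _ _ _ h => hinj h)).symm.trans_le
    (Finset.sum_le_univ_sum_of_nonneg fun I => sq_nonneg _)

lemma eLpNorm_mul_weight_mono {p : ℝ≥0∞} {s : ℝ} {f g : Vel d → ℝ} (h : ∀ v, |f v| ≤ g v) :
    eLpNorm (fun v => f v * weight s v) p volume ≤
      eLpNorm (fun v => g v * weight s v) p volume := by
  refine eLpNorm_mono_real fun v => ?_
  rw [Real.norm_eq_abs, abs_mul, abs_of_pos (weight_pos s v)]
  exact mul_le_mul_of_nonneg_right (h v) (weight_pos s v).le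

lemma eLpNorm_le_familyNorm {p : ℝ≥0∞} {s : ℝ} {D : DerivFamily d} {m j : ℕ} (hj : j ≤ m)
    (I : Fin j → Fin d) :
    eLpNorm (fun v => D j I v * weight s v) p volume ≤ familyNorm m p s D :=
  (eLpNorm_mul_weight_mono (abs_le_tensorLength (D j) I)).trans
    (Finset.single_le_sum
      (f := fun j => eLpNorm (fun v => tensorLength (D j) v * weight s v) p volume)
      (fun _ _ => zero_le) (Finset.mem_range.2 (Nat.lt_succ_of_le hj)))

lemma familyNorm_mono {p : ℝ≥0∞} {s : ℝ} {D : DerivFamily d} {m n : ℕ} (h : m ≤ n) :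
    familyNorm m p s D ≤ familyNorm n p s D :=
  Finset.sum_le_sum_of_subset (Finset.range_mono (by omega))

lemma familyNorm_shift_le {p : ℝ≥0∞} {s : ℝ} {D : DerivFamily d} (i : Fin d) (m : ℕ) :
    familyNorm m p s (shift D i) ≤ familyNorm (m + 1) p s D := by
  unfold familyNorm
  rw [Finset.sum_range_succ' _ (m + 1)]
  refine le_add_right (Finset.sum_le_sum fun j _ => eLpNorm_mul_weight_mono fun v => ?_)
  rw [abs_of_nonneg (tensorLength_nonneg _ _)]
  exact tensorLength_shift_le D i j v

/-- The terms of the iterated product rule distribute `n` derivatives over the two factors, and the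
estimate of order zero adds one derivative to one factor. Hence at most one factor ever carries
`n + 1` of them. -/
lemma eLpNorm_leibniz_le {T : (Vel d → ℝ) → (Vel d → ℝ) → Vel d → ℝ} (hL : IsLeibniz T)
    {p M : ℝ≥0∞} {q s : ℝ} (hp : 1 ≤ p)
    (hT : ∀ A B : DerivFamily d, IsSobolevFamily 1 A → IsSobolevFamily 1 B →
      eLpNorm (fun v => T (A 0 ![]) (B 0 ![]) v * weight q v) p volume ≤
        M * (familyNorm 0 p s A * familyNorm 1 p s B + familyNorm 1 p s A * familyNorm 0 p s B))
    {n : ℕ} : ∀ {A B : DerivFamily d}, IsSobolevFamily (n + 1) A → IsSobolevFamily (n + 1) B →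
      ∀ I, eLpNorm (fun v => leibniz T n A B I v * weight q v) p volume ≤
        2 ^ n * M * (familyNorm n p s A * familyNorm (n + 1) p s B +
          familyNorm (n + 1) p s A * familyNorm n p s B) := by
  have hw := (continuous_weight (d := d) q).aestronglyMeasurable (μ := volume)
  induction n with
  | zero => intro A B hA hB I; simpa [leibniz] using hT A B hA hB
  | succ n ih =>
    intro A B hA hB I
    have hA' := hA.mono (Nat.le_succ (n + 1))
    have hB' := hB.mono (Nat.le_succ (n + 1))
    have m1 := (hL.integrable_leibniz ((hA.shift (I 0)).mono (Nat.le_succ n))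
      (hB'.mono (Nat.le_succ n)) (Fin.tail I)).aestronglyMeasurable.mul hw
    have m2 := (hL.integrable_leibniz (hA'.mono (Nat.le_succ n))
      ((hB.shift (I 0)).mono (Nat.le_succ n)) (Fin.tail I)).aestronglyMeasurable.mul hw
    have e : (fun v => leibniz T (n + 1) A B I v * weight q v) =
        (fun v => leibniz T n (shift A (I 0)) B (Fin.tail I) v * weight q v) +
        fun v => leibniz T n A (shift B (I 0)) (Fin.tail I) v * weight q v := by
      ext v; simp only [leibniz, Pi.add_apply, add_mul]
    have up : ∀ D : DerivFamily d, familyNorm (n + 1) p s D ≤ familyNorm (n + 1 + 1) p s D :=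
      fun _ => familyNorm_mono (Nat.le_succ _)
    have up' : ∀ D : DerivFamily d, familyNorm n p s D ≤ familyNorm (n + 1) p s D :=
      fun _ => familyNorm_mono (Nat.le_succ _)
    rw [e]
    refine (eLpNorm_add_le m1 m2 hp).trans
      ((add_le_add (ih (hA.shift _) hB' _) (ih hA' (hB.shift _) _)).trans ?_)
    calc _ ≤ 2 ^ n * M * (familyNorm (n + 1) p s A * familyNorm (n + 1 + 1) p s B +
          familyNorm (n + 1 + 1) p s A * familyNorm (n + 1) p s B) +
          2 ^ n * M * (familyNorm (n + 1) p s A * familyNorm (n + 1 + 1) p s B +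
          familyNorm (n + 1 + 1) p s A * familyNorm (n + 1) p s B) := by
          exact add_le_add
            (mul_le_mul_right (add_le_add (mul_le_mul' (familyNorm_shift_le _ _) (up B))
              (mul_le_mul' (familyNorm_shift_le _ _) (up' B))) _)
            (mul_le_mul_right (add_le_add (mul_le_mul' (up' A) (familyNorm_shift_le _ _))
              (mul_le_mul' (up A) (familyNorm_shift_le _ _))) _)
      _ = _ := by rw [pow_succ]; ring

/-- A family whose members are bounded by `X` bounds the Sobolev norm. -/
lemma sobolevNorm_le {k : ℕ} {p X : ℝ≥0∞} {q : ℝ} (hp : 1 ≤ p) {h : Vel d → ℝ}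
    {G : DerivFamily d} (hG : ∀ j ≤ k, ∀ I : Fin j → Fin d, IsWeakDeriv I h (G j I))
    (hX : ∀ j ≤ k, ∀ I : Fin j → Fin d, eLpNorm (fun v => G j I v * weight q v) p volume ≤ X) :
    sobolevNorm k p q h ≤ (∑ j ∈ Finset.range (k + 1), (d : ℝ≥0∞) ^ j) * X := by
  refine (iInf₂_le G hG).trans ?_
  rw [Finset.sum_mul]
  refine Finset.sum_le_sum fun j hj => ?_
  have hj' : j ≤ k := Nat.lt_succ_iff.1 (Finset.mem_range.1 hj)
  have hw := (continuous_weight (d := d) q).aestronglyMeasurable (μ := volume)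
  have hm : ∀ I : Fin j → Fin d,
      AEStronglyMeasurable (fun v => |G j I v * weight q v|) volume := fun I =>
    ((hG j hj' I).2.1.aestronglyMeasurable.mul hw).norm
  calc eLpNorm (fun v => tensorLength (G j) v * weight q v) p volume
      ≤ eLpNorm (∑ I : Fin j → Fin d, fun v => |G j I v * weight q v|) p volume := by
        refine eLpNorm_mono_real fun v => ?_
        rw [Real.norm_eq_abs, abs_mul, abs_of_pos (weight_pos q v),
          abs_of_nonneg (tensorLength_nonneg _ _), Finset.sum_apply]
        simp_rw [abs_mul, abs_of_pos (weight_pos q v)]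
        rw [← Finset.sum_mul]
        exact mul_le_mul_of_nonneg_right (tensorLength_le_sum _ _) (weight_pos q v).le
    _ ≤ ∑ I : Fin j → Fin d, eLpNorm (fun v => |G j I v * weight q v|) p volume :=
        eLpNorm_sum_le (fun I _ => hm I) hp
    _ ≤ ∑ _I : Fin j → Fin d, X := by
        refine Finset.sum_le_sum fun I _ => ?_
        exact (eLpNorm_norm fun v => G j I v * weight q v).trans_le (hX j hj' I)
    _ = (d : ℝ≥0∞) ^ j * X := by simp

lemma IsWeakDeriv.ae_eq {j : ℕ} {I : Fin j → Fin d} {f w w' : Vel d → ℝ}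
    (h : IsWeakDeriv I f w) (h' : IsWeakDeriv I f w') : w =ᵐ[volume] w' := by
  refine ae_eq_of_integral_test_eq h.2.1 h'.2.1 fun ψ hψ => ?_
  have := (h.2.2 ψ hψ).symm.trans (h'.2.2 ψ hψ)
  exact mul_left_cancel₀ (pow_ne_zero j (by norm_num)) this

/-- Membership in a weighted Sobolev space provides a family of measurable representatives of the
weak derivatives, and this family computes all lower order norms. -/
lemma MemSobolev.exists_family {k : ℕ} {p C : ℝ≥0∞} {q s : ℝ} (hT : HasTransferBound d p q s C)
    {f : Vel d → ℝ} (hf : MemSobolev k p s f) :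
    ∃ A : DerivFamily d, IsSobolevFamily k A ∧ f =ᵐ[volume] A 0 ![] ∧
      ∀ m ≤ k, familyNorm m p s A ≤ sobolevNorm m p s f := by
  classical
  obtain ⟨D, hD⟩ := iInf_lt_iff.1 hf
  obtain ⟨hw, hD⟩ := iInf_lt_iff.1 hD
  -- Beyond order `k` nothing is known about `D`; the value `0` there is irrelevant.
  let A : DerivFamily d := fun j I =>
    if h : AEStronglyMeasurable (D j I) volume then h.mk (D j I) else 0
  have hAm : ∀ j I, Measurable (A j I) := fun j I => by
    by_cases h : AEStronglyMeasurable (D j I) volume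
    · simp only [A, h, dif_pos]; exact h.stronglyMeasurable_mk.measurable
    · simp only [A, h, dif_neg, not_false_eq_true]; exact measurable_zero
  have hDA : ∀ j ≤ k, ∀ I, D j I =ᵐ[volume] A j I := fun j hj I => by
    have h := (hw j hj I).2.1.aestronglyMeasurable
    simp only [A, h, dif_pos]
    exact h.ae_eq_mk
  have hf0 : f =ᵐ[volume] D 0 ![] := by
    have h0 := hw 0 (Nat.zero_le k) ![]
    refine ae_eq_of_integral_test_eq h0.1 h0.2.1 fun ψ hψ => ?_
    simpa [partialDeriv_zero] using h0.2.2 ψ hψ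
  have hfA := hf0.trans (hDA 0 (Nat.zero_le k) ![])
  have hnorm : ∀ m ≤ k, familyNorm m p s A ≤ sobolevNorm m p s f := by
    intro m hm
    refine le_iInf₂ fun D' hD' => Finset.sum_le_sum fun j hj => le_of_eq (eLpNorm_congr_ae ?_)
    have hj' : j ≤ m := Nat.lt_succ_iff.1 (Finset.mem_range.1 hj)
    have : ∀ᵐ v, ∀ I : Fin j → Fin d, A j I v = D' j I v := ae_all_iff.2 fun I =>
      (hDA j (hj'.trans hm) I).symm.trans ((hw j (hj'.trans hm) I).ae_eq (hD' j hj' I))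
    filter_upwards [this] with v hv
    simp only [tensorLength, hv]
  refine ⟨A, ⟨fun j hj I => hT.hasSecondMoment (hAm j I) ?_, fun j hj I φ hφ => ?_⟩, hfA, hnorm⟩
  · exact (eLpNorm_le_familyNorm hj I).trans_lt ((hnorm k le_rfl).trans_lt hf)
  · have h1 : ∫ v, A 0 ![] v * partialDeriv I φ v = ∫ v, f v * partialDeriv I φ v :=
      integral_congr_ae (by filter_upwards [hfA] with v hv; rw [hv])
    have h2 : ∫ v, A j I v * φ v = ∫ v, D j I v * φ v :=
      integral_congr_ae (by filter_upwards [hDA j hj I] with v hv; rw [hv])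
    rw [h1, h2]
    exact (hw j hj I).2.2 φ hφ

end Family

/-! ### The estimate of order `k` -/

section Estimate

variable {d : ℕ} {b : ℝ → ℝ}

/-- The difference of two gain operators, as a bilinear operator. The loss terms of two collision
operators cancel, so this is also the difference of the collision operators themselves. -/
def gainDiff (b : ℝ → ℝ) (β : ℝ) (f g : Vel d → ℝ) (v : Vel d) : ℝ :=
  gain b (1 / 2) f g v - gain b β f g v

/-- The symmetrisation of a bilinear operator. -/
def symmetrise (T : (Vel d → ℝ) → (Vel d → ℝ) → Vel d → ℝ) (f g : Vel d → ℝ) (v : Vel d) : ℝ :=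
  (1 / 2) * (T f g v + T g f v)

lemma IsAngularKernel.isLeibniz_gainDiff (hb : IsAngularKernel d b) {β : ℝ} (h0 : 0 ≤ β)
    (h1 : β ≤ 1 / 2) : IsLeibniz (gainDiff (d := d) b β) where
  integrable hf hg :=
    (hb.integrable_gain (by norm_num) le_rfl hf hg).sub (hb.integrable_gain h0 h1 hf hg)
  isWeakPartial {i f g f' g'} hf hg hf' hg' hff hgg φ hφ := by
    have k : ∀ {γ : ℝ}, 0 ≤ γ → γ ≤ 1 / 2 → ∀ {f g : Vel d → ℝ}, HasSecondMoment f →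
        HasSecondMoment g → ∀ {φ : Vel d → ℝ}, IsTest φ →
        Integrable fun v => gain b γ f g v * φ v :=
      fun h0 h1 _ _ hf hg _ hφ => integrable_mul_test (hb.integrable_gain h0 h1 hf hg) hφ
    have hz : (0 : ℝ) ≤ 1 / 2 := by norm_num
    have hw : ∀ {γ : ℝ}, 0 ≤ γ → γ ≤ 1 / 2 → ∫ v, gain b γ f g v * coordDeriv i φ v =
        -((∫ v, gain b γ f' g v * φ v) + ∫ v, gain b γ f g' v * φ v) := fun {γ} h0 h1 => by
      have := (hb.isTransferKernel h0 h1).isWeakPartial_transfer (by simp) hf hg hf' hg' hff hgg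
        φ hφ
      rw [← integral_add (k h0 h1 hf' hg hφ) (k h0 h1 hf hg' hφ)]
      simpa only [gain, add_mul] using this
    have s1 : Integrable fun v => gain b (1 / 2) f' g v * φ v - gain b β f' g v * φ v :=
      (k hz le_rfl hf' hg hφ).sub (k h0 h1 hf' hg hφ)
    have s2 : Integrable fun v => gain b (1 / 2) f g' v * φ v - gain b β f g' v * φ v :=
      (k hz le_rfl hf hg' hφ).sub (k h0 h1 hf hg' hφ)
    simp only [gainDiff, sub_mul, add_mul]
    rw [integral_sub (k hz le_rfl hf hg (hφ.isTest_coordDeriv i))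
      (k h0 h1 hf hg (hφ.isTest_coordDeriv i)), hw hz le_rfl, hw h0 h1, integral_add s1 s2,
      integral_sub (k hz le_rfl hf' hg hφ) (k h0 h1 hf' hg hφ),
      integral_sub (k hz le_rfl hf hg' hφ) (k h0 h1 hf hg' hφ)]
    ring

lemma IsLeibniz.symmetrise {T : (Vel d → ℝ) → (Vel d → ℝ) → Vel d → ℝ} (hT : IsLeibniz T) :
    IsLeibniz (symmetrise T) where
  integrable hf hg := ((hT.integrable hf hg).add (hT.integrable hg hf)).const_mul _
  isWeakPartial {i f g f' g'} hf hg hf' hg' hff hgg φ hφ := by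
    have hφ' := hφ.isTest_coordDeriv i
    have k : ∀ {f g : Vel d → ℝ}, HasSecondMoment f → HasSecondMoment g → ∀ {φ : Vel d → ℝ},
      IsTest φ → Integrable fun v => T f g v * φ v :=
      fun hf hg _ hφ => integrable_mul_test (hT.integrable hf hg) hφ
    have h1 := hT.isWeakPartial hf hg hf' hg' hff hgg φ hφ
    have h2 := hT.isWeakPartial hg hf hg' hf' hgg hff φ hφ
    simp only [add_mul] at h1 h2
    rw [integral_add (k hf' hg hφ) (k hf hg' hφ)] at h1
    rw [integral_add (k hg' hf hφ) (k hg hf' hφ)] at h2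
    have s1 : Integrable fun v => T f' g v * φ v + T g f' v * φ v :=
      (k hf' hg hφ).add (k hg hf' hφ)
    have s2 : Integrable fun v => T f g' v * φ v + T g' f v * φ v :=
      (k hf hg' hφ).add (k hg' hf hφ)
    simp only [Granular.symmetrise, add_mul, mul_assoc]
    rw [integral_const_mul, integral_add (k hf hg hφ') (k hg hf hφ'), h1, h2,
      integral_add (s1.const_mul _) (s2.const_mul _), integral_const_mul, integral_const_mul,
      integral_add (k hf' hg hφ) (k hg hf' hφ), integral_add (k hf hg' hφ) (k hg' hf hφ)]
    ring

lemma eLpNorm_gainDiff_le (hb : IsAngularKernel d b) {p C : ℝ≥0∞} {q s : ℝ} (hp : 1 ≤ p)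
    (hT : HasTransferBound d p q s C) {β : ℝ} (h0 : 0 ≤ β) (h1 : β ≤ 1 / 2) (A B : DerivFamily d)
    (hA : IsSobolevFamily 1 A) (hB : IsSobolevFamily 1 B) :
    eLpNorm (fun v => gainDiff b β (A 0 ![]) (B 0 ![]) v * weight q v) p volume ≤
      2 * ENNReal.ofReal (1 / 2 - β) * C * d *
        (familyNorm 0 p s A * familyNorm 1 p s B + familyNorm 1 p s A * familyNorm 0 p s B) := by
  refine (eLpNorm_gain_sub_gain_le hb hp hT h0 h1 le_rfl (hA.hasSecondMoment 0 (by omega) _)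
    (hB.hasSecondMoment 0 (by omega) _)
    (fun i => (hA.shift i).hasSecondMoment 0 le_rfl ![])
    (fun i => (hB.shift i).hasSecondMoment 0 le_rfl ![])
    hA.isWeakPartial hB.isWeakPartial).trans ?_
  rw [mul_assoc (2 * ENNReal.ofReal (1 / 2 - β) * C)]
  gcongr
  calc _ ≤ ∑ _i : Fin d, (familyNorm 1 p s A * familyNorm 0 p s B +
        familyNorm 0 p s A * familyNorm 1 p s B) := by
        refine Finset.sum_le_sum fun i _ => add_le_add
          (mul_le_mul' ?_ (eLpNorm_le_familyNorm le_rfl _))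
          (mul_le_mul' (eLpNorm_le_familyNorm le_rfl _) ?_)
        · exact (eLpNorm_le_familyNorm le_rfl _).trans (familyNorm_shift_le i 0)
        · exact (eLpNorm_le_familyNorm le_rfl _).trans (familyNorm_shift_le i 0)
    _ = _ := by simp [add_comm, mul_add]

lemma eLpNorm_symmetrise_le {T : (Vel d → ℝ) → (Vel d → ℝ) → Vel d → ℝ} (hL : IsLeibniz T)
    {p M : ℝ≥0∞} {q s : ℝ} (hp : 1 ≤ p)
    (hT : ∀ A B : DerivFamily d, IsSobolevFamily 1 A → IsSobolevFamily 1 B →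
      eLpNorm (fun v => T (A 0 ![]) (B 0 ![]) v * weight q v) p volume ≤
        M * (familyNorm 0 p s A * familyNorm 1 p s B + familyNorm 1 p s A * familyNorm 0 p s B))
    (A B : DerivFamily d) (hA : IsSobolevFamily 1 A) (hB : IsSobolevFamily 1 B) :
    eLpNorm (fun v => symmetrise T (A 0 ![]) (B 0 ![]) v * weight q v) p volume ≤
      2 * M * (familyNorm 0 p s A * familyNorm 1 p s B +
        familyNorm 1 p s A * familyNorm 0 p s B) := by
  have hA0 := hA.hasSecondMoment 0 (by omega) ![]
  have hB0 := hB.hasSecondMoment 0 (by omega) ![]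
  have hw := (continuous_weight (d := d) q).aestronglyMeasurable (μ := volume)
  calc _ ≤ eLpNorm ((fun v => T (A 0 ![]) (B 0 ![]) v * weight q v) +
        fun v => T (B 0 ![]) (A 0 ![]) v * weight q v) p volume := by
        refine eLpNorm_mono fun v => ?_
        simp only [symmetrise, Pi.add_apply, ← add_mul, Real.norm_eq_abs, abs_mul]
        gcongr
        rw [abs_of_nonneg (by norm_num : (0 : ℝ) ≤ 1 / 2)]
        linarith [abs_nonneg (T (A 0 ![]) (B 0 ![]) v + T (B 0 ![]) (A 0 ![]) v)]
    _ ≤ _ := eLpNorm_add_le ((hL.integrable hA0 hB0).aestronglyMeasurable.mul hw)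
        ((hL.integrable hB0 hA0).aestronglyMeasurable.mul hw) hp
    _ ≤ _ := add_le_add (hT A B hA hB) (hT B A hB hA)
    _ = _ := by ring

/-- From order `0` to order `k`, for any bilinear operator with the product rule. -/
lemma sobolevNorm_le_of_isLeibniz {T : (Vel d → ℝ) → (Vel d → ℝ) → Vel d → ℝ} (hL : IsLeibniz T)
    {p M : ℝ≥0∞} {q s : ℝ} (hp : 1 ≤ p)
    (hT : ∀ A B : DerivFamily d, IsSobolevFamily 1 A → IsSobolevFamily 1 B →
      eLpNorm (fun v => T (A 0 ![]) (B 0 ![]) v * weight q v) p volume ≤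
        M * (familyNorm 0 p s A * familyNorm 1 p s B + familyNorm 1 p s A * familyNorm 0 p s B))
    {k : ℕ} {A B : DerivFamily d} (hA : IsSobolevFamily (k + 1) A)
    (hB : IsSobolevFamily (k + 1) B) {h : Vel d → ℝ} (hh : h =ᵐ[volume] T (A 0 ![]) (B 0 ![])) :
    sobolevNorm k p q h ≤ (∑ j ∈ Finset.range (k + 1), (d : ℝ≥0∞) ^ j) * (2 ^ k * M *
      (familyNorm k p s A * familyNorm (k + 1) p s B +
        familyNorm (k + 1) p s A * familyNorm k p s B)) := by
  have hA0 := hA.hasSecondMoment 0 (by omega) ![]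
  have hB0 := hB.hasSecondMoment 0 (by omega) ![]
  refine sobolevNorm_le hp (G := fun j => leibniz T j A B) (fun j hj I => ⟨?_, ?_, ?_⟩)
    fun j hj I => ?_
  · exact ((hL.integrable hA0 hB0).congr hh.symm).locallyIntegrable
  · exact (hL.integrable_leibniz (hA.mono (by omega)) (hB.mono (by omega)) I).locallyIntegrable
  · intro φ hφ
    rw [← hL.integral_partialDeriv (hA.mono (by omega)) (hB.mono (by omega)) I hφ]
    exact integral_congr_ae (by filter_upwards [hh] with v hv; rw [hv])
  · refine (eLpNorm_leibniz_le hL hp hT (hA.mono (by omega)) (hB.mono (by omega)) I).trans ?_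
    have u : ∀ D : DerivFamily d, familyNorm j p s D ≤ familyNorm k p s D :=
      fun _ => familyNorm_mono hj
    have u' : ∀ D : DerivFamily d, familyNorm (j + 1) p s D ≤ familyNorm (k + 1) p s D :=
      fun _ => familyNorm_mono (by omega)
    have h2 : (2 : ℝ≥0∞) ^ j ≤ 2 ^ k := pow_le_pow_right₀ (by norm_num) hj
    exact mul_le_mul' (mul_le_mul' h2 le_rfl)
      (add_le_add (mul_le_mul' (u A) (u' B)) (mul_le_mul' (u' A) (u B)))

/-- The estimate in any weighted `L^p` scale in which the transfer operators are bounded. The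
displacement for the restitution coefficient `α` is `(1 + α)/4 (|u| σ - u)`, and
`1/2 - (1 + α)/4 = (1 - α)/4`; the factor `α^{-a}` is only lost at the end. -/
lemma exists_sobolevNorm_sub_le (hb : IsAngularKernel d b) {p C : ℝ≥0∞} {q s : ℝ} (hp : 1 ≤ p)
    (hT : HasTransferBound d p q s C) (hC : C ≠ ⊤) (k a : ℕ) :
    ∃ c : ℝ, 0 < c ∧ ∀ (F : Form) (α : ℝ), 0 < α → α ≤ 1 →
      ∀ f g : Vel d → ℝ, MemSobolev (k + 1) p s f → MemSobolev (k + 1) p s g →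
        (∃ Q₁, IsCollision F b 1 g f Q₁) ∧ (∃ Qα, IsCollision F b α g f Qα) ∧
        ∀ Q₁ Qα : Vel d → ℝ, IsCollision F b 1 g f Q₁ → IsCollision F b α g f Qα →
          sobolevNorm k p q (fun v => Q₁ v - Qα v) ≤
            ENNReal.ofReal (c * ((1 - α) / α ^ a)) *
              (sobolevNorm k p s f * sobolevNorm (k + 1) p s g +
                sobolevNorm k p s g * sobolevNorm (k + 1) p s f) := by
  set S : ℝ≥0∞ := ∑ j ∈ Finset.range (k + 1), (d : ℝ≥0∞) ^ j with hS
  set X : ℝ≥0∞ := S * (2 ^ k * (2 * (2 * C * d))) with hX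
  have hS' : S ≠ ⊤ := ENNReal.sum_ne_top.2 fun j _ => ENNReal.pow_ne_top (ENNReal.natCast_ne_top d)
  have hX' : X ≠ ⊤ := by
    refine ENNReal.mul_ne_top hS' (ENNReal.mul_ne_top (ENNReal.pow_ne_top (by simp))
      (ENNReal.mul_ne_top (by simp) (ENNReal.mul_ne_top (ENNReal.mul_ne_top (by simp) hC) ?_)))
    exact ENNReal.natCast_ne_top d
  refine ⟨X.toReal + 1, by positivity, fun F α hα0 hα1 f g hf hg => ?_⟩
  obtain ⟨A, hA, hfA, hAn⟩ := hf.exists_family hT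
  obtain ⟨B, hB, hgB, hBn⟩ := hg.exists_family hT
  have hA0 := hA.hasSecondMoment 0 (by omega) ![]
  have hB0 := hB.hasSecondMoment 0 (by omega) ![]
  have ex : ∀ γ : ℝ, 0 < γ → γ ≤ 1 → IsCollision F b γ g f
      (collisionOp F b ((1 + γ) / 4) (A 0 ![]) (B 0 ![])) := fun γ h0 h1 =>
    (hb.isCollision_collisionOp F h0 h1 hA0 hB0).congr hfA.symm hgB.symm
  refine ⟨⟨_, ex 1 one_pos le_rfl⟩, ⟨_, ex α hα0 hα1⟩, fun Q₁ Qα hQ₁ hQα => ?_⟩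
  have hβ0 : 0 ≤ (1 + α) / 4 := by linarith
  have hβ1 : (1 + α) / 4 ≤ 1 / 2 := by linarith
  have e1 := hQ₁.ae_eq (ex 1 one_pos le_rfl)
  have e2 := hQα.ae_eq (ex α hα0 hα1)
  rw [show ((1 : ℝ) + 1) / 4 = 1 / 2 by norm_num] at e1
  set M : ℝ≥0∞ := 2 * ENNReal.ofReal (1 / 2 - (1 + α) / 4) * C * d with hM
  have hL := hb.isLeibniz_gainDiff hβ0 hβ1
  have hbd := eLpNorm_gainDiff_le hb hp hT hβ0 hβ1
  have main : sobolevNorm k p q (fun v => Q₁ v - Qα v) ≤ S * (2 ^ k * (2 * M) *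
      (familyNorm k p s A * familyNorm (k + 1) p s B +
        familyNorm (k + 1) p s A * familyNorm k p s B)) := by
    cases F with
    | gainLoss =>
      refine (sobolevNorm_le_of_isLeibniz hL hp hbd hA hB ?_).trans ?_
      · filter_upwards [e1, e2] with v h1 h2
        rw [h1, h2]; simp only [collisionOp, gainDiff]; ring
      · exact mul_le_mul_right (mul_le_mul_left (mul_le_mul_right
          (le_mul_of_one_le_left' (by norm_num)) _) _) _
    | symmetric =>
      refine sobolevNorm_le_of_isLeibniz hL.symmetrise hp (eLpNorm_symmetrise_le hL hp hbd) hA hB ?_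
      filter_upwards [e1, e2] with v h1 h2
      rw [h1, h2]; simp only [collisionOp, symmetrise, gainDiff]; ring
  refine main.trans ?_
  have hc : S * (2 ^ k * (2 * M)) ≤ ENNReal.ofReal ((X.toReal + 1) * ((1 - α) / α ^ a)) := by
    calc S * (2 ^ k * (2 * M)) = X * ENNReal.ofReal (1 / 2 - (1 + α) / 4) := by
          rw [hX, hM]; ring
      _ ≤ ENNReal.ofReal (X.toReal + 1) * ENNReal.ofReal ((1 - α) / α ^ a) := by
          refine mul_le_mul' ?_ (ENNReal.ofReal_le_ofReal ?_)
          · rw [ENNReal.le_ofReal_iff_toReal_le hX' (by positivity)]; linarith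
          · rw [le_div_iff₀ (pow_pos hα0 a)]
            have := pow_le_one₀ hα0.le hα1 (n := a)
            have := (pow_pos hα0 a).le
            nlinarith
      _ = _ := (ENNReal.ofReal_mul (by positivity)).symm
  calc _ = S * (2 ^ k * (2 * M)) * (familyNorm k p s A * familyNorm (k + 1) p s B +
        familyNorm k p s B * familyNorm (k + 1) p s A) := by ring
    _ ≤ _ := mul_le_mul' hc (add_le_add (mul_le_mul' (hAn k (by omega)) (hBn _ le_rfl))
        (mul_le_mul' (hBn k (by omega)) (hAn _ le_rfl)))

end Estimate

end Granular

end

open Granular in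
theorem lemma2p1 (d : ℕ) (hd : 2 ≤ d) (b : ℝ → ℝ) (hb : IsAngularKernel d b)
    (k : ℕ) (q : ℝ) (hq : 0 ≤ q) :
    (∃ c : ℝ, 0 < c ∧ ∀ (F : Form) (α : ℝ), 0 < α → α ≤ 1 →
      ∀ f g : Vel d → ℝ, MemSobolev (k + 1) 1 (q + 2) f → MemSobolev (k + 1) 1 (q + 2) g →
        (∃ Q₁, IsCollision F b 1 g f Q₁) ∧ (∃ Qα, IsCollision F b α g f Qα) ∧
        ∀ Q₁ Qα : Vel d → ℝ, IsCollision F b 1 g f Q₁ → IsCollision F b α g f Qα →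
          sobolevNorm k 1 q (fun v => Q₁ v - Qα v) ≤
            ENNReal.ofReal (c * ((1 - α) / α ^ max (d - 1) 2)) *
              (sobolevNorm k 1 (q + 2) f * sobolevNorm (k + 1) 1 (q + 2) g +
                sobolevNorm k 1 (q + 2) g * sobolevNorm (k + 1) 1 (q + 2) f)) ∧
    (∀ κ : ℝ, (d : ℝ) / 2 < κ → ∃ c : ℝ, 0 < c ∧ ∀ (F : Form) (α : ℝ), 0 < α → α ≤ 1 →
      ∀ f g : Vel d → ℝ,
        MemSobolev (k + 1) 2 (q + κ + 2) f → MemSobolev (k + 1) 2 (q + κ + 2) g →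
        (∃ Q₁, IsCollision F b 1 g f Q₁) ∧ (∃ Qα, IsCollision F b α g f Qα) ∧
        ∀ Q₁ Qα : Vel d → ℝ, IsCollision F b 1 g f Q₁ → IsCollision F b α g f Qα →
          sobolevNorm k 2 q (fun v => Q₁ v - Qα v) ≤
            ENNReal.ofReal (c * ((1 - α) / α ^ max (d - 1) 2)) *
              (sobolevNorm k 2 (q + κ + 2) f * sobolevNorm (k + 1) 2 (q + κ + 2) g +
                sobolevNorm k 2 (q + κ + 2) g * sobolevNorm (k + 1) 2 (q + κ + 2) f)) := by
  refine ⟨exists_sobolevNorm_sub_le hb le_rfl (hasTransferBound_one hq) ENNReal.ofReal_ne_top k _,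
    fun κ hκ => exists_sobolevNorm_sub_le hb (by norm_num) (hasTransferBound_two hq hκ) ?_ k _⟩
  refine ENNReal.rpow_ne_top_of_nonneg (by norm_num)
    (ENNReal.mul_ne_top (lintegral_eweight_lt_top ?_).ne ENNReal.ofReal_ne_top)
  linarith
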